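/- An MV-algebra is an algebra $\langle A,\oplus,\neg,0\rangle$ such that $\langle A,\oplus,0\rangle$ is a commutative monoid, $\neg\neg x\approx x$, $x\oplus\neg 0\approx\neg 0$ and $\neg(\neg x\oplus y)\oplus y\approx\neg(\neg y\oplus x)\oplus x$; put $1:=\neg 0$, $x\to y:=\neg x\oplus y$, $x*y:=\neg(\neg x\oplus\neg y)$, $x\vee y:=(x\to y)\to y$. A monadic MV-algebra is an algebra $\langle A,\oplus,\neg,0,\exists,\forall\rangle$ whose reduct $\langle A,\oplus,\neg,0\rangle$ is an MV-algebra and which satisfies the identities $$\forall x\to x\approx 1,\quad \forall(x\to\forall y)\approx\exists x\to\forall y,\quad \forall(\forall x\to y)\approx\forall x\to\forall y,\quad \forall(\exists x\vee y)\approx\exists x\vee\forall y,\quad \exists(x*x)\approx\exists x*\exists x .$$ Let $\mathbb{MMV}$ be the class of all monadic MV-algebras. A quasivariety is a class of algebras of this signature axiomatized by a set of quasi-identities $s_1\approx t_1\mathbin{\&}\dots\mathbin{\&}s_n\approx t_n\Rightarrow s\approx t$ ($n\ge 0$), and the quasivariety generated by a class $K$ is the least quasivariety containing $K$. Let $[0,1]_{\text{Ł}}$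 be the MV-algebra on the real unit interval with $x\oplus y=\min(1,x+y)$ and $\neg x=1-x$, and for $m\ge 1$ let $\mathbf L_m$ be the $(m+1)$-element MV-chain (the subalgebra $\{0,\tfrac1m,\dots,\tfrac{m-1}m,1\}$ of $[0,1]_{\text{Ł}}$, up to isomorphism). For $\mathbf C$ one of these chains and a non-empty set $X$, let $\langle\mathbf C^X,\exists_\vee,\forall_\wedge\rangle$ be the algebra of all functions $X\to C$ with pointwise MV-operations and, for all $x \in X$, $$\exists_\vee(f)(x)=\bigvee\{f(y):y\in X\},\qquad \forall_\wedge(f)(x)=\bigwedge\{f(y):y\in X\};$$ write $k$ in place of $X$ when $|X|=k$ is finite, and $\omega$ when $X=\mathbb N$. Then: 1. $\mathbb{MMV}$ is generated as a quasivariety by the algebras $\langle\mathbf L_m^\omega,\exists_\vee,\forall_\wedge\rangle$, $m\ge 1$. 2. $\mathbb{MMV}$ is generated as a quasivariety by the algebras $\langle[0,1]_{\text{Ł}}^k,\exists_\vee,\forall_\wedge\rangle$, $k\ge 1$. 3. $\mathbb{MMV}$ is generated as a quasivariety by the single algebra $\langle[0,1]_{\text{Ł}}^\omega,\exists_\vee,\forall_\wedge\rangle$.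 -/

import Mathlib

open FirstOrder FirstOrder.Language CategoryTheory

universe u

/-- The operation symbols of monadic MV-algebras: the MV-operations `0`, `¬`, `⊕` and the two
quantifiers `∃`, `∀`, with their arities. -/
inductive MonadicMVFunc : ℕ → Type
  | zero : MonadicMVFunc 0
  | neg : MonadicMVFunc 1
  | plus : MonadicMVFunc 2
  | ex : MonadicMVFunc 1
  | all : MonadicMVFunc 1

/-- The algebraic signature of monadic MV-algebras. -/
def monadicMVLang : FirstOrder.Language.{0, 0} := ⟨MonadicMVFunc, fun _ => Empty⟩

/-- An arbitrary algebra of this signature, with carrier in `Type u`. -/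
abbrev MonadicMVAlg : Type (u + 1) := Bundled.{u} monadicMVLang.Structure

namespace MonadicMV

section Operations

variable {A : Type u} [monadicMVLang.Structure A]

/-- The constant `0`. -/
def zero : A := Structure.funMap (L := monadicMVLang) MonadicMVFunc.zero ![]

/-- Negation `¬ x`. -/
def neg (x : A) : A := Structure.funMap (L := monadicMVLang) MonadicMVFunc.neg ![x]

/-- Truncated sum `x ⊕ y`. -/
def plus (x y : A) : A := Structure.funMap (L := monadicMVLang) MonadicMVFunc.plus ![x, y]

/-- The quantifier `∃ x`. -/
def ex (x : A) : A := Structure.funMap (L := monadicMVLang) MonadicMVFunc.ex ![x]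

/-- The quantifier `∀ x`. -/
def all (x : A) : A := Structure.funMap (L := monadicMVLang) MonadicMVFunc.all ![x]

/-- `1 = ¬ 0`. -/
def one : A := neg zero

/-- `x → y = ¬ x ⊕ y`. -/
def imp (x y : A) : A := plus (neg x) y

/-- `x * y = ¬ (¬ x ⊕ ¬ y)`. -/
def mul (x y : A) : A := neg (plus (neg x) (neg y))

/-- `x ∨ y = (x → y) → y`. -/
def join (x y : A) : A := imp (imp x y) y

end Operations

/-- The defining identities of MV-algebras (for the reduct `⟨A, ⊕, ¬, 0⟩`). -/
structure IsMV (A : Type u) [monadicMVLang.Structure A] : Prop where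
  plus_assoc : ∀ x y z : A, plus x (plus y z) = plus (plus x y) z
  plus_comm : ∀ x y : A, plus x y = plus y x
  plus_zero : ∀ x : A, plus x zero = x
  neg_neg : ∀ x : A, neg (neg x) = x
  plus_one : ∀ x : A, plus x (neg zero) = neg zero
  lukasiewicz : ∀ x y : A, plus (neg (plus (neg x) y)) y = plus (neg (plus (neg y) x)) x

/-- Monadic MV-algebras: MV-algebras with two unary operations `∃`, `∀` satisfying (M1)-(M5). -/
structure IsMonadicMV (A : Type u) [monadicMVLang.Structure A] : Prop extends IsMV A where
  m1 : ∀ x : A, imp (all x) x = one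
  m2 : ∀ x y : A, all (imp x (all y)) = imp (ex x) (all y)
  m3 : ∀ x y : A, all (imp (all x) y) = imp (all x) (all y)
  m4 : ∀ x y : A, all (join (ex x) y) = join (ex x) (all y)
  m5 : ∀ x : A, ex (mul x x) = mul (ex x) (ex x)

end MonadicMV

/-- The class `MMV` of all monadic MV-algebras. -/
def MMV : Set MonadicMVAlg.{u} := {A | MonadicMV.IsMonadicMV A}

/-- A quasi-identity `s₁ ≈ t₁ & ... & sₙ ≈ tₙ ⇒ s ≈ t` (with `n = 0` allowed), in variables
indexed by `ℕ`. -/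
structure QuasiIdentity where
  /-- The pairs `(sᵢ, tᵢ)`. -/
  premises : List (monadicMVLang.Term ℕ × monadicMVLang.Term ℕ)
  /-- The term `s`. -/
  lhs : monadicMVLang.Term ℕ
  /-- The term `t`. -/
  rhs : monadicMVLang.Term ℕ

/-- Validity of a quasi-identity in an algebra. -/
def QuasiIdentity.HoldsIn (q : QuasiIdentity) (A : MonadicMVAlg.{u}) : Prop :=
  ∀ v : ℕ → A, (∀ p ∈ q.premises, p.1.realize v = p.2.realize v) →
    q.lhs.realize v = q.rhs.realize v

/-- A quasivariety is a class of algebras axiomatized by a set of quasi-identities. -/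
def IsQuasivariety (Q : Set MonadicMVAlg.{u}) : Prop :=
  ∃ Θ : Set QuasiIdentity, Q = {A | ∀ q ∈ Θ, q.HoldsIn A}

/-- `Q` is the quasivariety generated by the class `K`: the least quasivariety containing `K`. -/
def IsGeneratedAsQuasivarietyBy (Q K : Set MonadicMVAlg.{u}) : Prop :=
  IsLeast {R | IsQuasivariety R ∧ K ⊆ R} Q

/-- The MV-operations on the standard chains. -/
class MVOps (C : Type) where
  /-- The constant `0`. -/
  zero : C
  /-- Negation. -/
  neg : C → C
  /-- Truncated sum. -/
  plus : C → C → C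

/-- The standard MV-algebra on `[0,1]`: `¬ x = 1 - x` and `x ⊕ y = min (1, x + y)`. -/
noncomputable instance unitIntervalMVOps : MVOps unitInterval where
  zero := 0
  neg x := ⟨1 - x, sub_nonneg.mpr x.2.2, sub_le_self 1 x.2.1⟩
  plus x y := ⟨min 1 ((x : ℝ) + y),
    le_min zero_le_one (add_nonneg x.2.1 y.2.1), min_le_left _ _⟩

/-- The `(m+1)`-element MV-chain, with `j : Fin (m + 1)` standing for `j / m`:
`¬ j = m - j` and `i ⊕ j = min (m, i + j)`. -/
instance finMVOps (m : ℕ) : MVOps (Fin (m + 1)) where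
  zero := 0
  neg j := ⟨m - j, by omega⟩
  plus i j := ⟨min m ((i : ℕ) + j), by omega⟩

/-- The structure `⟨C^X, ∃_∨, ∀_∧⟩` on the set of all functions from `X` to a complete chain `C`:
the MV-operations are pointwise, and `∃ f`, `∀ f` are the constant functions with values the
supremum and the infimum of `f`. -/
noncomputable abbrev functionStructure (C : Type) [CompleteLinearOrder C] [MVOps C]
    (X : Type u) : monadicMVLang.Structure (X → C) where
  funMap := fun {_} F => match F with
    | MonadicMVFunc.zero => fun _ _ => MVOps.zero
    | MonadicMVFunc.neg => fun a x => MVOps.neg (a 0 x)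
    | MonadicMVFunc.plus => fun a x => MVOps.plus (a 0 x) (a 1 x)
    | MonadicMVFunc.ex => fun a _ => ⨆ y, a 0 y
    | MonadicMVFunc.all => fun a _ => ⨅ y, a 0 y
  RelMap := fun r => r.elim

/-- The algebra `⟨C^X, ∃_∨, ∀_∧⟩`. -/
noncomputable def functionAlgebra (C : Type) [CompleteLinearOrder C] [MVOps C] (X : Type u) :
    MonadicMVAlg.{u} :=
  ⟨X → C, functionStructure C X⟩

/-!
A quasi-identity that fails in a monadic MV-algebra `A` fails at finitely many elements of `A`, so
it is enough to map a finite part `S` of `A` into some `⟨Ł_m^k, ∃_∨, ∀_∧⟩`, preserving the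
operations as far as they stay in `S` and separating two given elements.

The coordinates are prime ideals of `A`, whose quotients are chains. Fix a prime ideal `J` of the
MV-algebra of elements fixed by the quantifiers. As `∀ (∃ t - t) = 0`, where `x - y = ¬ (¬ x ⊕ y)`,
for each `t` there is a prime ideal of `A` that meets the fixed elements in `J` and contains
`∃ t - t`, that is, in whose quotient `t` attains the value of `∃ t`. Finitely many such ideals
witness all quantifiers in `S`.

The resulting chains share the chain of fixed elements modulo `J`, and they have to be mapped into
one `Ł_m` in such a way that their maps agree on it. The Chang groups of these chains are
amalgamated over that of the common chain. A torsion-free abelian group has homomorphisms to `ℚ`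
that make any finite set of elements positive, provided that no non-trivial combination of them
with natural coefficients vanishes; this is Farkas' lemma. Such a homomorphism, applied to the
positive differences of the elements of `S`, embeds the relevant part of every chain into `Ł_m`,
where `m` is a common multiple of the denominators of its values.

Finally, `Ł_m` embeds into `[0, 1]`, and a surjection `X → k` embeds `C^k` into `C^X`; suprema and
infima are preserved because those over `k` are attained.
-/

universe w

/-- MV-algebras, written additively with `xᶜ` for the negation. -/
class MVAlgebra (A : Type*) extends AddCommMonoid A, Compl A where
  protected compl_compl : ∀ x : A, xᶜᶜ = x
  add_compl_zero : ∀ x : A, x + 0ᶜ = 0ᶜ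
  lukasiewicz : ∀ x y : A, (xᶜ + y)ᶜ + y = (yᶜ + x)ᶜ + x

namespace MVAlgebra

section Basic

variable {A : Type*} [MVAlgebra A]

instance : Sub A := ⟨fun x y => (xᶜ + y)ᶜ⟩

instance : Top A := ⟨0ᶜ⟩

theorem sub_def (x y : A) : x - y = (xᶜ + y)ᶜ := rfl

theorem top_def : (⊤ : A) = 0ᶜ := rfl

attribute [simp] MVAlgebra.compl_compl

@[simp] protected theorem compl_top : (⊤ : A)ᶜ = 0 := MVAlgebra.compl_compl 0

@[simp] protected theorem compl_zero : (0 : A)ᶜ = ⊤ := rfl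

@[simp] protected theorem add_top (x : A) : x + ⊤ = ⊤ := add_compl_zero x

@[simp] protected theorem top_add (x : A) : ⊤ + x = ⊤ := by rw [add_comm, MVAlgebra.add_top]

theorem compl_add_self (x : A) : xᶜ + x = ⊤ := by
  simpa using (lukasiewicz x (⊤ : A)).symm

protected theorem sub_add_comm (x y : A) : x - y + y = y - x + x := lukasiewicz x y

instance : LE A := ⟨fun x y => x - y = 0⟩

theorem le_iff_sub_eq_zero {x y : A} : x ≤ y ↔ x - y = 0 := Iff.rfl

theorem le_iff_compl_add_eq_top {x y : A} : x ≤ y ↔ xᶜ + y = ⊤ := by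
  rw [le_iff_sub_eq_zero, sub_def]
  constructor
  · intro h
    rw [← MVAlgebra.compl_compl (xᶜ + y), h, MVAlgebra.compl_zero]
  · intro h
    rw [h, MVAlgebra.compl_top]

protected theorem le_add_right (x c : A) : x ≤ x + c := by
  rw [le_iff_compl_add_eq_top, ← add_assoc, compl_add_self, MVAlgebra.top_add]

theorem sub_add_of_le {x y : A} (h : x ≤ y) : y - x + x = y := by
  rw [MVAlgebra.sub_add_comm, le_iff_sub_eq_zero.1 h, zero_add]

instance : PartialOrder A where
  le_refl x := by rw [le_iff_compl_add_eq_top, compl_add_self]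
  le_trans x y z hxy hyz := by
    rw [← sub_add_of_le hyz, ← sub_add_of_le hxy, add_comm, add_comm _ x, add_assoc]
    exact MVAlgebra.le_add_right _ _
  le_antisymm x y hxy hyx := by
    rw [← sub_add_of_le hyx, le_iff_sub_eq_zero.1 hxy, zero_add]

instance : IsOrderedAddMonoid A where
  add_le_add_left x y h z := by
    rw [← sub_add_of_le h, add_comm _ x, add_right_comm]
    exact MVAlgebra.le_add_right _ _

instance : CanonicallyOrderedAdd A where
  exists_add_of_le {x y} h := ⟨y - x, by rw [add_comm, sub_add_of_le h]⟩
  le_add_self x y := by rw [add_comm]; exact MVAlgebra.le_add_right x y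
  le_self_add := MVAlgebra.le_add_right

instance : OrderedSub A where
  tsub_le_iff_right x y z := by
    rw [le_iff_compl_add_eq_top, le_iff_compl_add_eq_top, sub_def, MVAlgebra.compl_compl,
      add_comm z, add_assoc]

instance : OrderTop A where
  le_top x := by rw [le_iff_compl_add_eq_top, MVAlgebra.add_top]

@[simp] protected theorem compl_le_compl_iff {x y : A} : yᶜ ≤ xᶜ ↔ x ≤ y := by
  rw [le_iff_compl_add_eq_top, le_iff_compl_add_eq_top, MVAlgebra.compl_compl, add_comm]

@[simp] theorem compl_sub_compl (x y : A) : xᶜ - yᶜ = y - x := by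
  rw [sub_def, sub_def, MVAlgebra.compl_compl, add_comm]

theorem compl_add (x y : A) : (x + y)ᶜ = xᶜ - y := by rw [sub_def, MVAlgebra.compl_compl]

theorem compl_sub (x y : A) : (x - y)ᶜ = xᶜ + y := by rw [sub_def, MVAlgebra.compl_compl]

theorem sub_compl_comm (x y : A) : x - yᶜ = y - xᶜ := by rw [sub_def, sub_def, add_comm]

theorem add_eq_top_iff {x y : A} : x + y = ⊤ ↔ xᶜ ≤ y := by
  rw [le_iff_compl_add_eq_top, MVAlgebra.compl_compl]

theorem compl_eq_top_iff {x : A} : xᶜ = ⊤ ↔ x = 0 := by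
  rw [← top_le_iff, MVAlgebra.top_def, MVAlgebra.compl_le_compl_iff, nonpos_iff_eq_zero]

theorem sub_sub_self_eq_compl (x y : A) : x - (x - y) = (yᶜ - xᶜ + xᶜ)ᶜ := by
  rw [compl_sub_compl, sub_def x (x - y), add_comm]

theorem sub_sub_self_comm (x y : A) : x - (x - y) = y - (y - x) := by
  rw [sub_sub_self_eq_compl, sub_sub_self_eq_compl, MVAlgebra.sub_add_comm]

instance : Lattice A where
  sup x y := x - y + y
  inf x y := x - (x - y)
  le_sup_left _ _ := le_tsub_add
  le_sup_right _ _ := le_add_self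
  sup_le x y z hx hy :=
    calc x - y + y ≤ z - y + y := by gcongr
      _ = z := sub_add_of_le hy
  inf_le_left _ _ := tsub_le_self
  inf_le_right x y := by
    rw [sub_sub_self_comm]
    exact tsub_le_self
  le_inf x y z hy hz := by
    rw [sub_sub_self_eq_compl, ← MVAlgebra.compl_le_compl_iff, MVAlgebra.compl_compl]
    calc zᶜ - yᶜ + yᶜ ≤ xᶜ - yᶜ + yᶜ := by gcongr; rwa [MVAlgebra.compl_le_compl_iff]
      _ = xᶜ := sub_add_of_le (MVAlgebra.compl_le_compl_iff.2 hy)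

theorem inf_def (x y : A) : x ⊓ y = x - (x - y) := rfl

theorem sub_add_inf (x y : A) : x - y + x ⊓ y = x := by
  rw [add_comm]
  exact sub_add_of_le tsub_le_self

theorem add_sub_self_eq_inf (x y : A) : x + y - y = x ⊓ yᶜ := by
  rw [inf_def, sub_sub_self_eq_compl, MVAlgebra.compl_compl, MVAlgebra.sub_add_comm, ← compl_add,
    sub_def]

theorem add_sub_cancel_of_le {x y : A} (h : x ≤ yᶜ) : x + y - y = x := by
  rw [add_sub_self_eq_inf, inf_eq_left.2 h]

theorem sub_inf_sub_eq_zero (x y : A) : (x - y) ⊓ (y - x) = 0 := by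
  set z := (x - y) ⊓ (y - x)
  have add_le_of_le {a b : A} (h : z ≤ a - b) : z + a ⊓ b ≤ a :=
    calc z + a ⊓ b ≤ a - b + a ⊓ b := by gcongr
      _ = a := sub_add_inf a b
  have add_inf_le : z + x ⊓ y ≤ 0 + x ⊓ y := by
    rw [zero_add]
    exact le_inf (add_le_of_le inf_le_left) (inf_comm x y ▸ add_le_of_le inf_le_right)
  have le_compl : z ≤ (x ⊓ y)ᶜ :=
    calc z ≤ x - y := inf_le_left
      _ = yᶜ - xᶜ := (compl_sub_compl _ _).symm
      _ ≤ yᶜ := tsub_le_self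
      _ ≤ (x ⊓ y)ᶜ := MVAlgebra.compl_le_compl_iff.2 inf_le_right
  rw [← nonpos_iff_eq_zero, ← add_sub_cancel_of_le le_compl]
  exact tsub_le_iff_right.2 add_inf_le

theorem add_inf_le (x y z : A) : (x + y) ⊓ z ≤ x ⊓ z + y ⊓ z := by
  set t := (x + y) ⊓ z
  have le_add : t ≤ x + y := inf_le_left
  have le_z : t ≤ z := inf_le_right
  calc t = t - y + t ⊓ y := (sub_add_inf t y).symm
    _ ≤ x ⊓ z + y ⊓ z := add_le_add
      (le_inf (tsub_le_iff_right.2 le_add) (tsub_le_self.trans le_z))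
      (le_inf inf_le_right (inf_le_left.trans le_z))

end Basic

/-- Homomorphisms of MV-algebras. -/
structure IsHom {A B : Type*} [MVAlgebra A] [MVAlgebra B] (f : A → B) : Prop where
  map_zero : f 0 = 0
  map_add : ∀ x y, f (x + y) = f x + f y
  map_compl : ∀ x, f xᶜ = (f x)ᶜ

namespace IsHom

variable {A B : Type*} [MVAlgebra A] [MVAlgebra B] {f : A → B}

theorem map_top (hf : IsHom f) : f ⊤ = ⊤ := by
  rw [MVAlgebra.top_def, hf.map_compl, hf.map_zero, MVAlgebra.top_def]

theorem map_sub (hf : IsHom f) (x y : A) : f (x - y) = f x - f y := by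
  rw [sub_def, sub_def, hf.map_compl, hf.map_add, hf.map_compl]

theorem monotone (hf : IsHom f) : Monotone f := by
  intro x y h
  rw [le_iff_sub_eq_zero, ← hf.map_sub, le_iff_sub_eq_zero.1 h, hf.map_zero]

end IsHom

/-- Ideals of an MV-algebra. -/
structure IsIdeal {A : Type*} [MVAlgebra A] (I : Set A) : Prop where
  zero_mem : (0 : A) ∈ I
  add_mem : ∀ {x y : A}, x ∈ I → y ∈ I → x + y ∈ I
  mem_of_le : ∀ {x y : A}, x ≤ y → y ∈ I → x ∈ I

/-- Proper prime ideals: those whose quotient is a non-trivial chain. -/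
structure IsPrimeIdeal {A : Type*} [MVAlgebra A] (I : Set A) : Prop extends IsIdeal I where
  top_notMem : (⊤ : A) ∉ I
  sub_mem_or_sub_mem : ∀ x y : A, x - y ∈ I ∨ y - x ∈ I

section Ideal

variable {A : Type*} [MVAlgebra A] {I D : Set A}

theorem IsPrimeIdeal.mem_or_mem (hI : IsPrimeIdeal I) {x y : A} (h : x ⊓ y ∈ I) :
    x ∈ I ∨ y ∈ I := by
  rcases hI.sub_mem_or_sub_mem x y with h' | h'
  · left
    rw [← sub_add_inf x y]
    exact hI.add_mem h' h
  · right
    rw [← sub_add_inf y x, inf_comm]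
    exact hI.add_mem h' h

theorem isIdeal_singleton_zero : IsIdeal ({0} : Set A) where
  zero_mem := rfl
  add_mem := by
    rintro _ _ rfl rfl
    exact add_zero _
  mem_of_le := by
    rintro x _ h rfl
    exact nonpos_iff_eq_zero.1 h

theorem IsIdeal.colon (hI : IsIdeal I) (a : A) : IsIdeal {z | z ⊓ a ∈ I} where
  zero_mem := hI.mem_of_le inf_le_left hI.zero_mem
  add_mem hx hy := hI.mem_of_le (add_inf_le _ _ _) (hI.add_mem hx hy)
  mem_of_le h hy := hI.mem_of_le (inf_le_inf_right a h) hy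

theorem isIdeal_sUnion {c : Set (Set A)} (hc : IsChain (· ⊆ ·) c) (hne : c.Nonempty)
    (hideal : ∀ I ∈ c, IsIdeal I) : IsIdeal (⋃₀ c) where
  zero_mem :=
    let ⟨I, hI⟩ := hne
    ⟨I, hI, (hideal I hI).zero_mem⟩
  add_mem := by
    rintro x y ⟨I, hI, hx⟩ ⟨K, hK, hy⟩
    rcases hc.total hI hK with h | h
    · exact ⟨K, hK, (hideal K hK).add_mem (h hx) hy⟩
    · exact ⟨I, hI, (hideal I hI).add_mem hx (h hy)⟩
  mem_of_le := by
    rintro x y hxy ⟨I, hI, hy⟩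
    exact ⟨I, hI, (hideal I hI).mem_of_le hxy hy⟩

theorem IsIdeal.image_add_nsmul {B : Type*} [MVAlgebra B] {J : Set B} (hJ : IsIdeal J)
    {f : B → A} (hf : IsHom f) (w : A) :
    IsIdeal {z | ∃ q ∈ J, ∃ n : ℕ, z ≤ f q + n • w} where
  zero_mem := ⟨0, hJ.zero_mem, 0, zero_le⟩
  add_mem := by
    rintro x y ⟨q, hq, n, hx⟩ ⟨q', hq', n', hy⟩
    refine ⟨q + q', hJ.add_mem hq hq', n + n', (add_le_add hx hy).trans_eq ?_⟩
    rw [add_nsmul, hf.map_add, add_add_add_comm]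
  mem_of_le := by
    rintro x y hxy ⟨q, hq, n, h⟩
    exact ⟨q, hq, n, hxy.trans h⟩

theorem isPrimeIdeal_of_maximal_disjoint (hD : D.Nonempty) (hinf : InfClosed D)
    (hI : Maximal (fun K => IsIdeal K ∧ Disjoint K D) I) : IsPrimeIdeal I := by
  obtain ⟨hideal, hdisj⟩ := hI.prop
  have exists_inf_mem {a b : A} (hba : b ⊓ a ∈ I) (hb : b ∉ I) : ∃ d ∈ D, d ⊓ a ∈ I := by
    by_contra! hD
    have hcolon : IsIdeal {z | z ⊓ a ∈ I} ∧ Disjoint {z | z ⊓ a ∈ I} D :=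
      ⟨hideal.colon a, Set.disjoint_left.2 fun z hz hzD => hD z hzD hz⟩
    exact hb (hI.le_of_ge hcolon (fun z hz => hideal.mem_of_le inf_le_left hz) hba)
  refine ⟨hideal, fun htop => ?_, fun x y => ?_⟩
  · obtain ⟨d, hd⟩ := hD
    exact Set.disjoint_left.1 hdisj (hideal.mem_of_le le_top htop) hd
  · by_contra! h
    have h0 : (x - y) ⊓ (y - x) ∈ I := sub_inf_sub_eq_zero x y ▸ hideal.zero_mem
    obtain ⟨d, hd, hdy⟩ := exists_inf_mem h0 h.1
    obtain ⟨e, he, hed⟩ := exists_inf_mem (inf_comm d _ ▸ hdy) h.2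
    exact Set.disjoint_left.1 hdisj hed (hinf he hd)

theorem exists_isPrimeIdeal_of_disjoint (hI : IsIdeal I) (hD : D.Nonempty) (hinf : InfClosed D)
    (hdisj : Disjoint I D) : ∃ P, IsPrimeIdeal P ∧ I ⊆ P ∧ Disjoint P D := by
  obtain ⟨P, hIP, hP⟩ := zorn_subset_nonempty {K : Set A | IsIdeal K ∧ Disjoint K D}
    (fun c hc hchain hne => ⟨⋃₀ c, ⟨isIdeal_sUnion hchain hne fun K hK => (hc hK).1,
      Set.disjoint_sUnion_left.2 fun K hK => (hc hK).2⟩,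
      fun _ => Set.subset_sUnion_of_mem⟩) I ⟨hI, hdisj⟩
  exact ⟨P, isPrimeIdeal_of_maximal_disjoint hD hinf hP, hIP, hP.prop.2⟩

theorem exists_isPrimeIdeal_notMem {a : A} (ha : a ≠ 0) : ∃ P, IsPrimeIdeal P ∧ a ∉ P := by
  obtain ⟨P, hP, -, hdisj⟩ := exists_isPrimeIdeal_of_disjoint isIdeal_singleton_zero
    (Set.singleton_nonempty a) infClosed_singleton (Set.disjoint_singleton.2 ha.symm)
  exact ⟨P, hP, Set.disjoint_singleton_right.1 hdisj⟩

/-- The congruence `x - y, y - x ∈ I` of an ideal `I`; its quotient is the quotient MV-algebra. -/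
def IsIdeal.addCon (hI : IsIdeal I) : AddCon A where
  r x y := x - y ∈ I ∧ y - x ∈ I
  iseqv :=
    { refl := fun x => by simpa using hI.zero_mem
      symm := fun h => ⟨h.2, h.1⟩
      trans := fun {x y z} h h' =>
        ⟨hI.mem_of_le (tsub_le_tsub_add_tsub (b := y)) (hI.add_mem h.1 h'.1),
          hI.mem_of_le (tsub_le_tsub_add_tsub (b := y)) (hI.add_mem h'.2 h.2)⟩ }
  add' h h' :=
    ⟨hI.mem_of_le add_tsub_add_le_tsub_add_tsub (hI.add_mem h.1 h'.1),
      hI.mem_of_le add_tsub_add_le_tsub_add_tsub (hI.add_mem h.2 h'.2)⟩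

instance (hI : IsIdeal I) : MVAlgebra hI.addCon.Quotient where
  compl := Quotient.map' compl fun x y h => by
    change xᶜ - yᶜ ∈ I ∧ yᶜ - xᶜ ∈ I
    rw [compl_sub_compl, compl_sub_compl]
    exact ⟨h.2, h.1⟩
  compl_compl x := by
    induction x using Quotient.inductionOn'
    exact congrArg _ (MVAlgebra.compl_compl _)
  add_compl_zero x := by
    induction x using Quotient.inductionOn'
    exact congrArg _ (MVAlgebra.add_top _)
  lukasiewicz x y := by
    induction x using Quotient.inductionOn'
    induction y using Quotient.inductionOn'
    exact congrArg _ (lukasiewicz _ _)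

theorem IsIdeal.mk_le_mk (hI : IsIdeal I) {x y : A} :
    (x : hI.addCon.Quotient) ≤ y ↔ x - y ∈ I := by
  have h : (x : hI.addCon.Quotient) ≤ y ↔ ((x - y : A) : hI.addCon.Quotient) = (0 : A) := Iff.rfl
  rw [h, AddCon.eq]
  change x - y - 0 ∈ I ∧ 0 - (x - y) ∈ I ↔ _
  simp [hI.zero_mem]

theorem IsIdeal.mk_eq_mk (hI : IsIdeal I) {x y : A} :
    (x : hI.addCon.Quotient) = y ↔ x - y ∈ I ∧ y - x ∈ I :=
  AddCon.eq _

/-- The map induced on quotients by a homomorphism `f`, for an ideal `J` with `J = f ⁻¹' I`. -/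
def IsHom.quotientMap {B : Type*} [MVAlgebra B] {f : B → A} (hf : IsHom f) (hI : IsIdeal I)
    {J : Set B} (hJ : IsIdeal J) (hJI : ∀ b, f b ∈ I ↔ b ∈ J) :
    hJ.addCon.Quotient → hI.addCon.Quotient :=
  Quotient.map' f fun b c h => by
    change f b - f c ∈ I ∧ f c - f b ∈ I
    rwa [← hf.map_sub, ← hf.map_sub, hJI, hJI]

section QuotientMap

variable {B : Type*} [MVAlgebra B] {f : B → A} (hf : IsHom f) (hI : IsIdeal I)
  {J : Set B} (hJ : IsIdeal J) (hJI : ∀ b, f b ∈ I ↔ b ∈ J)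

theorem IsHom.isHom_quotientMap : IsHom (hf.quotientMap hI hJ hJI) where
  map_zero := congrArg _ hf.map_zero
  map_add x y := by
    induction x using Quotient.inductionOn'
    induction y using Quotient.inductionOn'
    exact congrArg _ (hf.map_add _ _)
  map_compl x := by
    induction x using Quotient.inductionOn'
    exact congrArg _ (hf.map_compl _)

theorem IsHom.quotientMap_injective : Function.Injective (hf.quotientMap hI hJ hJI) := by
  intro x y h
  induction x using Quotient.inductionOn' with | _ b
  induction y using Quotient.inductionOn' with | _ c
  have h' := hI.mk_eq_mk.1 h
  rw [← hf.map_sub, ← hf.map_sub, hJI, hJI] at h'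
  exact hJ.mk_eq_mk.2 h'

end QuotientMap

end Ideal

/-- Non-trivial totally ordered MV-algebras. -/
class IsMVChain (C : Type*) [MVAlgebra C] : Prop where
  le_or_le : ∀ x y : C, x ≤ y ∨ y ≤ x
  zero_ne_top : (0 : C) ≠ ⊤

open Classical in
/-- The linear order of an MV-chain. -/
noncomputable abbrev IsMVChain.linearOrder (C : Type*) [MVAlgebra C] [IsMVChain C] :
    LinearOrder C :=
  haveI : Std.Total (α := C) (· ≤ ·) := ⟨IsMVChain.le_or_le⟩
  Lattice.toLinearOrder C

theorem IsPrimeIdeal.isMVChain {A : Type*} [MVAlgebra A] {I : Set A} (hI : IsPrimeIdeal I) :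
    IsMVChain hI.addCon.Quotient where
  le_or_le x y := by
    induction x using Quotient.inductionOn'
    induction y using Quotient.inductionOn'
    exact (hI.sub_mem_or_sub_mem _ _).imp hI.mk_le_mk.2 hI.mk_le_mk.2
  zero_ne_top h := by
    have htop : ((⊤ : A) : hI.addCon.Quotient) ≤ (0 : A) := h.ge
    rw [hI.mk_le_mk, tsub_zero] at htop
    exact hI.top_notMem htop

section LukasiewiczProduct

/- As `a - bᶜ` is the Łukasiewicz product of `a` and `b`, these are the cases of the associative law
of the Chang group. -/

variable {C : Type*} [MVAlgebra C] {a b c : C}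

theorem sub_compl_sub_compl (a b c : C) : a - bᶜ - cᶜ = a - (b - cᶜ)ᶜ := by
  rw [compl_sub, tsub_add_eq_tsub_tsub]

theorem sub_compl_add_of_eq_top_of_eq_top (hab : a + b = ⊤) (hbc : b + c = ⊤) :
    a - bᶜ + c = a + (b - cᶜ) := by
  have hba : bᶜ ≤ a := add_eq_top_iff.1 (add_comm b a ▸ hab)
  have hbc : bᶜ ≤ c := add_eq_top_iff.1 hbc
  calc a - bᶜ + c = a - bᶜ + (c - bᶜ + bᶜ) := by rw [sub_add_of_le hbc]
    _ = a - bᶜ + bᶜ + (c - bᶜ) := by rw [add_comm (c - bᶜ), add_assoc]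
    _ = a + (b - cᶜ) := by rw [sub_add_of_le hba, sub_compl_comm b c]

variable [IsMVChain C]

theorem le_compl_of_add_ne_top (h : a + b ≠ ⊤) : a ≤ bᶜ :=
  (IsMVChain.le_or_le a bᶜ).resolve_right fun hba =>
    h (add_comm b a ▸ add_eq_top_iff.2 hba)

theorem add_sub_compl_of_ne_top (hab : a + b ≠ ⊤) (hbc : b + c ≠ ⊤) :
    a + b - cᶜ = a - (b + c)ᶜ :=
  calc a + b - cᶜ = a + b - (cᶜ - b + b) := by
        rw [sub_add_of_le (le_compl_of_add_ne_top hbc)]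
    _ = a + b - b - (cᶜ - b) := tsub_add_eq_tsub_tsub_swap _ _ _
    _ = a - (b + c)ᶜ := by
        rw [add_sub_cancel_of_le (le_compl_of_add_ne_top hab), add_comm b c, compl_add]

theorem sub_compl_add_of_eq_top_of_ne_top (hab : a + b = ⊤) (hbc : b + c ≠ ⊤) :
    a - bᶜ + c = a - (b + c)ᶜ := by
  have hba : bᶜ ≤ a := add_eq_top_iff.1 (add_comm b a ▸ hab)
  have hcb : bᶜ - c + c = bᶜ := sub_add_of_le (le_compl_of_add_ne_top (add_comm b c ▸ hbc))
  have hc : c ≤ a - (bᶜ - c) :=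
    calc c = c + (bᶜ - c) - (bᶜ - c) := by
          refine (add_sub_cancel_of_le ?_).symm
          rw [compl_sub]
          exact le_add_self
      _ ≤ a - (bᶜ - c) := tsub_le_tsub_right (by rwa [add_comm, hcb]) _
  calc a - bᶜ + c = a - (bᶜ - c + c) + c := by rw [hcb]
    _ = a - (bᶜ - c) - c + c := by rw [tsub_add_eq_tsub_tsub]
    _ = a - (b + c)ᶜ := by rw [sub_add_of_le hc, compl_add]

end LukasiewiczProduct

end MVAlgebra

/-- Chang's totally ordered group of an MV-chain `C`: its elements have an integral part and a
proper fractional part in `C`. -/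
@[ext]
structure ChangGroup (C : Type*) [MVAlgebra C] where
  whole : ℤ
  frac : C
  frac_ne_top : frac ≠ ⊤

namespace ChangGroup

open MVAlgebra

variable {C : Type*} [MVAlgebra C]

open Classical in
noncomputable instance : Add (ChangGroup C) where
  add x y := if h : x.frac + y.frac = ⊤ then
      ⟨x.whole + y.whole + 1, x.frac - y.fracᶜ, ne_top_of_le_ne_top x.frac_ne_top tsub_le_self⟩
    else ⟨x.whole + y.whole, x.frac + y.frac, h⟩

theorem add_of_eq_top {x y : ChangGroup C} (h : x.frac + y.frac = ⊤) :
    x + y = ⟨x.whole + y.whole + 1, x.frac - y.fracᶜ,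
      ne_top_of_le_ne_top x.frac_ne_top tsub_le_self⟩ :=
  dif_pos h

theorem add_of_ne_top {x y : ChangGroup C} (h : x.frac + y.frac ≠ ⊤) :
    x + y = ⟨x.whole + y.whole, x.frac + y.frac, h⟩ :=
  dif_neg h

protected theorem add_comm (x y : ChangGroup C) : x + y = y + x := by
  by_cases h : x.frac + y.frac = ⊤
  · rw [add_of_eq_top h, add_of_eq_top (by rwa [add_comm])]
    ext
    · simp only [add_comm]
    · exact sub_compl_comm _ _
  · rw [add_of_ne_top h, add_of_ne_top (by rwa [add_comm])]
    ext
    · exact add_comm _ _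
    · exact add_comm _ _

theorem add_assoc_of_eq_top_of_eq_top {x y z : ChangGroup C} (hxy : x.frac + y.frac = ⊤)
    (hyz : y.frac + z.frac = ⊤) : x + y + z = x + (y + z) := by
  have hfrac := sub_compl_add_of_eq_top_of_eq_top hxy hyz
  rw [add_of_eq_top hxy, add_of_eq_top hyz]
  by_cases h : x.frac + (y.frac - z.fracᶜ) = ⊤
  · rw [add_of_eq_top (hfrac.trans h), add_of_eq_top h]
    ext
    · simp only
      ring
    · exact sub_compl_sub_compl _ _ _
  · rw [add_of_ne_top (ne_of_eq_of_ne hfrac h), add_of_ne_top h]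
    ext
    · simp only
      ring
    · exact hfrac

variable [IsMVChain C]

theorem add_assoc_of_eq_top_of_ne_top {x y z : ChangGroup C} (hxy : x.frac + y.frac = ⊤)
    (hyz : y.frac + z.frac ≠ ⊤) : x + y + z = x + (y + z) := by
  have hfrac := sub_compl_add_of_eq_top_of_ne_top hxy hyz
  have hne : x.frac - y.fracᶜ + z.frac ≠ ⊤ :=
    hfrac ▸ ne_top_of_le_ne_top x.frac_ne_top tsub_le_self
  have heq : x.frac + (y.frac + z.frac) = ⊤ := by rw [← add_assoc, hxy, MVAlgebra.top_add]
  rw [add_of_eq_top hxy, add_of_ne_top hyz, add_of_ne_top hne, add_of_eq_top heq]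
  ext
  · simp only
    ring
  · exact hfrac

theorem add_assoc_of_ne_top_of_ne_top {x y z : ChangGroup C} (hxy : x.frac + y.frac ≠ ⊤)
    (hyz : y.frac + z.frac ≠ ⊤) : x + y + z = x + (y + z) := by
  have hfrac := add_assoc x.frac y.frac z.frac
  rw [add_of_ne_top hxy, add_of_ne_top hyz]
  by_cases h : x.frac + (y.frac + z.frac) = ⊤
  · rw [add_of_eq_top (hfrac.trans h), add_of_eq_top h]
    ext
    · simp only [add_assoc]
    · exact add_sub_compl_of_ne_top hxy hyz
  · rw [add_of_ne_top (ne_of_eq_of_ne hfrac h), add_of_ne_top h]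
    ext
    · exact add_assoc _ _ _
    · exact hfrac

protected theorem add_assoc (x y z : ChangGroup C) : x + y + z = x + (y + z) := by
  by_cases hxy : x.frac + y.frac = ⊤ <;> by_cases hyz : y.frac + z.frac = ⊤
  · exact add_assoc_of_eq_top_of_eq_top hxy hyz
  · exact add_assoc_of_eq_top_of_ne_top hxy hyz
  · calc x + y + z = z + (y + x) := by rw [ChangGroup.add_comm, ChangGroup.add_comm x]
      _ = z + y + x := (add_assoc_of_eq_top_of_ne_top (add_comm y.frac z.frac ▸ hyz)
          (add_comm x.frac y.frac ▸ hxy)).symm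
      _ = x + (y + z) := by rw [ChangGroup.add_comm, ChangGroup.add_comm z]
  · exact add_assoc_of_ne_top_of_ne_top hxy hyz

instance : Zero (ChangGroup C) := ⟨⟨0, 0, IsMVChain.zero_ne_top⟩⟩

open Classical in
noncomputable instance : Neg (ChangGroup C) where
  neg x := if h : x.frac = 0 then ⟨-x.whole, 0, IsMVChain.zero_ne_top⟩
    else ⟨-x.whole - 1, x.fracᶜ, mt compl_eq_top_iff.1 h⟩

protected theorem zero_add (x : ChangGroup C) : 0 + x = x := by
  have h : (0 : ChangGroup C).frac + x.frac = x.frac := zero_add _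
  rw [add_of_ne_top (ne_of_eq_of_ne h x.frac_ne_top)]
  ext
  · exact zero_add _
  · exact h

protected theorem neg_add_cancel (x : ChangGroup C) : -x + x = 0 := by
  by_cases h : x.frac = 0
  · have hneg : -x = ⟨-x.whole, 0, IsMVChain.zero_ne_top⟩ := dif_pos h
    rw [hneg, add_of_ne_top (by rw [zero_add]; exact x.frac_ne_top)]
    ext
    · exact neg_add_cancel _
    · exact (zero_add _).trans h
  · have hneg : -x = ⟨-x.whole - 1, x.fracᶜ, mt compl_eq_top_iff.1 h⟩ := dif_neg h
    rw [hneg, add_of_eq_top (compl_add_self _)]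
    ext
    · change -x.whole - 1 + x.whole + 1 = 0
      ring
    · exact tsub_self _

noncomputable instance : AddCommGroup (ChangGroup C) where
  add_assoc := ChangGroup.add_assoc
  zero_add := ChangGroup.zero_add
  add_zero x := by rw [ChangGroup.add_comm, ChangGroup.zero_add]
  nsmul := nsmulRec
  zsmul := zsmulRec
  neg_add_cancel := ChangGroup.neg_add_cancel
  add_comm := ChangGroup.add_comm

noncomputable instance : LinearOrder (ChangGroup C) :=
  letI := IsMVChain.linearOrder C
  LinearOrder.lift' (fun x : ChangGroup C => toLex (x.whole, x.frac)) fun _ _ h =>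
    ChangGroup.ext (congrArg (fun z => (ofLex z).1) h) (congrArg (fun z => (ofLex z).2) h)

theorem le_iff {x y : ChangGroup C} :
    x ≤ y ↔ x.whole < y.whole ∨ x.whole = y.whole ∧ x.frac ≤ y.frac :=
  letI := IsMVChain.linearOrder C
  Prod.Lex.toLex_le_toLex

instance : IsOrderedAddMonoid (ChangGroup C) where
  add_le_add_left x y h z := by
    rw [le_iff] at h
    by_cases hx : x.frac + z.frac = ⊤ <;> by_cases hy : y.frac + z.frac = ⊤
    · rw [add_of_eq_top hx, add_of_eq_top hy, le_iff]
      dsimp only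
      exact h.imp (by omega) (And.imp (by omega) (tsub_le_tsub_right · _))
    · rw [add_of_eq_top hx, add_of_ne_top hy, le_iff]
      rcases h with hlt | ⟨-, hle⟩
      · have hfrac : x.frac - z.fracᶜ ≤ y.frac + z.frac := by
          rw [sub_compl_comm]
          exact tsub_le_self.trans le_add_self
        dsimp only
        rcases (Int.add_one_le_iff.2 hlt).lt_or_eq with h' | h'
        · left
          omega
        · exact Or.inr ⟨by omega, hfrac⟩
      · exact absurd (top_le_iff.1 (hx ▸ add_le_add_left hle _)) hy
    · rw [add_of_ne_top hx, add_of_eq_top hy, le_iff]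
      left
      dsimp only
      omega
    · rw [add_of_ne_top hx, add_of_ne_top hy, le_iff]
      dsimp only
      exact h.imp (by omega) (And.imp (by omega) (add_le_add_left · _))

open Classical in
/-- The embedding of an MV-chain as the interval `[0, 1]` of its Chang group, where `1` has whole
part `1` and fractional part `0`. -/
noncomputable def of (a : C) : ChangGroup C :=
  if h : a = ⊤ then ⟨1, 0, IsMVChain.zero_ne_top⟩ else ⟨0, a, h⟩

theorem of_top : of (⊤ : C) = ⟨1, 0, IsMVChain.zero_ne_top⟩ := dif_pos rfl

theorem of_of_ne_top {a : C} (h : a ≠ ⊤) : of a = ⟨0, a, h⟩ := dif_neg h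

@[simp] theorem of_zero : of (0 : C) = 0 := of_of_ne_top IsMVChain.zero_ne_top

theorem of_le_of {a b : C} : of a ≤ of b ↔ a ≤ b := by
  by_cases ha : a = ⊤ <;> by_cases hb : b = ⊤
  · simp [ha, hb]
  · subst ha
    simp [of_top, of_of_ne_top hb, le_iff, hb]
  · subst hb
    simp [of_top, of_of_ne_top ha, le_iff]
  · simp [of_of_ne_top ha, of_of_ne_top hb, le_iff]

theorem of_strictMono : StrictMono (of : C → ChangGroup C) :=
  strictMono_of_le_iff_le fun _ _ => of_le_of.symm

theorem of_nonneg (a : C) : 0 ≤ of a := by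
  rw [← of_zero, of_le_of]
  exact zero_le

theorem of_top_pos : 0 < of (⊤ : C) := by
  rw [← of_zero]
  exact of_strictMono (lt_top_iff_ne_top.2 IsMVChain.zero_ne_top)

theorem of_add (a b : C) : of (a + b) = min (of ⊤) (of a + of b) := by
  by_cases ha : a = ⊤
  · rw [ha, MVAlgebra.top_add, min_eq_left (le_add_of_nonneg_right (of_nonneg _))]
  by_cases hb : b = ⊤
  · rw [hb, MVAlgebra.add_top, min_eq_left (le_add_of_nonneg_left (of_nonneg _))]
  rw [of_of_ne_top ha, of_of_ne_top hb]
  by_cases h : a + b = ⊤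
  · rw [h, add_of_eq_top h, of_top, min_eq_left]
    exact le_iff.2 (Or.inr ⟨rfl, zero_le⟩)
  · rw [of_of_ne_top h, add_of_ne_top h, of_top, min_eq_right]
    · rfl
    · exact le_iff.2 (Or.inl zero_lt_one)

theorem of_compl (a : C) : of aᶜ = of ⊤ - of a := by
  rw [eq_sub_iff_add_eq]
  by_cases ha : a = ⊤
  · rw [ha, MVAlgebra.compl_top, of_zero, zero_add]
  by_cases h : aᶜ = ⊤
  · rw [h, compl_eq_top_iff.1 h, of_zero, add_zero]
  · rw [of_of_ne_top ha, of_of_ne_top h, of_top, add_of_eq_top (compl_add_self _)]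
    ext
    · rfl
    · exact tsub_self _

section Map

variable {D : Type*} [MVAlgebra D] [IsMVChain D] {f : C → D} (hf : IsHom f)
  (hinj : Function.Injective f)

/-- The homomorphism of Chang groups induced by an embedding of MV-chains. -/
noncomputable def map : ChangGroup C →+ ChangGroup D where
  toFun x := ⟨x.whole, f x.frac, hf.map_top ▸ hinj.ne x.frac_ne_top⟩
  map_zero' := ChangGroup.ext rfl hf.map_zero
  map_add' x y := by
    by_cases h : x.frac + y.frac = ⊤
    · have hmap : f x.frac + f y.frac = ⊤ := by rw [← hf.map_add, h, hf.map_top]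
      rw [add_of_eq_top h, add_of_eq_top hmap]
      ext
      · rfl
      · exact (hf.map_sub _ _).trans (congrArg _ (hf.map_compl _))
    · have hmap : f x.frac + f y.frac ≠ ⊤ := by
        rw [← hf.map_add, ← hf.map_top]
        exact hinj.ne h
      rw [add_of_ne_top h, add_of_ne_top hmap]
      ext
      · rfl
      · exact hf.map_add _ _

theorem map_strictMono : StrictMono (map hf hinj) := by
  refine Monotone.strictMono_of_injective (fun x y h => ?_) fun x y h => ?_
  · rw [le_iff] at *
    exact h.imp id (And.imp id fun h' => hf.monotone h')
  · exact ChangGroup.ext (congrArg whole h :) (hinj (congrArg frac h :))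

theorem map_of (a : C) : map hf hinj (of a) = of (f a) := by
  by_cases h : a = ⊤
  · rw [h, hf.map_top, of_top, of_top]
    exact ChangGroup.ext rfl hf.map_zero
  · rw [of_of_ne_top h, of_of_ne_top (hf.map_top ▸ hinj.ne h)]
    rfl

end Map

end ChangGroup

section Farkas

variable {R W ι : Type*} [Field R] [LinearOrder R] [IsStrictOrderedRing R] [AddCommGroup W]
  [Module R W] {s : Finset ι} {a : ι → Module.Dual R W} {b : Module.Dual R W}

theorem exists_apply_eq_neg_one_of_not_forall_nonneg [DecidableEq ι] {k : ι}
    (h : ∀ x, (∀ i ∈ insert k s, 0 ≤ a i x) → 0 ≤ b x)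
    (hs : ¬ ∀ x, (∀ i ∈ s, 0 ≤ a i x) → 0 ≤ b x) :
    ∃ x, (∀ i ∈ s, 0 ≤ a i x) ∧ b x ≤ 0 ∧ a k x = -1 := by
  obtain ⟨y, hsy, hby⟩ : ∃ y, (∀ i ∈ s, 0 ≤ a i y) ∧ b y < 0 := by simpa using hs
  have hky : a k y < 0 := by
    by_contra! hky
    exact hby.not_ge (h y ((Finset.forall_mem_insert _ _ _).2 ⟨hky, hsy⟩))
  have hc : 0 < -(a k y)⁻¹ := neg_pos.2 (inv_lt_zero.2 hky)
  refine ⟨(-(a k y)⁻¹) • y, fun i hi => ?_, ?_, ?_⟩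
  · rw [map_smul]
    exact smul_nonneg hc.le (hsy i hi)
  · rw [map_smul]
    exact smul_nonpos_of_nonneg_of_nonpos hc.le hby.le
  · simp [hky.ne]

/-- Farkas' lemma, by induction on the number of constraints (Bartl): if the last constraint `a k`
is needed, there is `x₀` with `a k x₀ = -1`, and restricting the other forms along the projection
`x ↦ x + a k x • x₀` onto the kernel of `a k` eliminates it. -/
theorem mem_hull_image_of_forall_nonneg
    (h : ∀ x, (∀ i ∈ s, 0 ≤ a i x) → 0 ≤ b x) : b ∈ PointedCone.hull R (a '' s) := by
  classical
  induction s using Finset.induction generalizing a b with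
  | empty =>
    have hb : b = 0 := by
      ext x
      have hneg := h (-x) (by simp)
      rw [map_neg] at hneg
      exact le_antisymm (neg_nonneg.1 hneg) (h x (by simp))
    exact hb ▸ zero_mem _
  | insert k s _ ih =>
    rw [Finset.coe_insert]
    by_cases hs : ∀ x, (∀ i ∈ s, 0 ≤ a i x) → 0 ≤ b x
    · exact Submodule.span_mono (Set.image_mono (Set.subset_insert k s)) (ih hs)
    obtain ⟨x₀, hsx₀, hbx₀, hkx₀⟩ := exists_apply_eq_neg_one_of_not_forall_nonneg h hs
    have hmem : b + b x₀ • a k ∈ PointedCone.hull R ((fun i => a i + a i x₀ • a k) '' s) := by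
      refine ih fun x hx => ?_
      have hb := h (x + a k x • x₀) ((Finset.forall_mem_insert _ _ _).2
        ⟨by simp [hkx₀], fun i hi => by simpa [mul_comm] using hx i hi⟩)
      simpa [mul_comm] using hb
    have hk : a k ∈ PointedCone.hull R (a '' insert k (s : Set ι)) :=
      PointedCone.subset_hull ⟨k, Set.mem_insert _ _, rfl⟩
    have hle : PointedCone.hull R ((fun i => a i + a i x₀ • a k) '' s) ≤
        PointedCone.hull R (a '' insert k (s : Set ι)) := by
      refine Submodule.span_le.2 ?_
      rintro _ ⟨i, hi, rfl⟩
      exact add_mem (PointedCone.subset_hull ⟨i, Set.mem_insert_of_mem _ hi, rfl⟩)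
        (PointedCone.smul_mem _ (hsx₀ i hi) hk)
    have hb : b = (b + b x₀ • a k) + (-b x₀) • a k := by module
    rw [hb]
    exact add_mem (hle hmem) (PointedCone.smul_mem _ (neg_nonneg.2 hbx₀) hk)

end Farkas

theorem exists_nsmul_eq_of_mem_hull {E M : Type*} [AddCommMonoid E] [AddCommGroup M] [Module ℚ M]
    (f : E →+ M) {T : Set E} {c : M} (hc : c ∈ PointedCone.hull ℚ (f '' T)) :
    ∃ n : ℕ, 0 < n ∧ ∃ e ∈ AddSubmonoid.closure T, n • c = f e := by
  induction hc using Submodule.span_induction with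
  | mem _ h =>
    obtain ⟨e, he, rfl⟩ := h
    exact ⟨1, one_pos, e, AddSubmonoid.subset_closure he, one_nsmul _⟩
  | zero => exact ⟨1, one_pos, 0, zero_mem _, by simp⟩
  | add x y _ _ hx hy =>
    obtain ⟨n, hn, e, he, hx⟩ := hx
    obtain ⟨m, hm, d, hd, hy⟩ := hy
    refine ⟨n * m, mul_pos hn hm, m • e + n • d, add_mem (nsmul_mem he m) (nsmul_mem hd n), ?_⟩
    rw [map_add, map_nsmul, map_nsmul, ← hx, ← hy, smul_smul, smul_smul, mul_comm m, nsmul_add]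
  | smul r x _ hx =>
    obtain ⟨n, hn, e, he, hx⟩ := hx
    obtain ⟨q, hq⟩ := r
    refine ⟨q.den * n, mul_pos q.den_pos hn, q.num.toNat • e, nsmul_mem he _, ?_⟩
    rw [map_nsmul, ← hx]
    change (q.den * n) • q • x = _
    simp only [← Nat.cast_smul_eq_nsmul ℚ, smul_smul]
    congr 1
    have hnum : ((q.num.toNat : ℕ) : ℚ) = q.num := by
      exact_mod_cast Int.toNat_of_nonneg (Rat.num_nonneg.2 hq)
    rw [hnum, Nat.cast_mul, ← Rat.mul_den_eq_num]
    ring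

theorem isOfFinAddOrder_of_forall_addMonoidHom_eq_zero {E : Type*} [AddCommGroup E] {e : E}
    (h : ∀ φ : E →+ ℚ, φ e = 0) : IsOfFinAddOrder e := by
  by_contra he
  have hinj := injective_zsmul_iff_not_isOfFinAddOrder.2 he
  obtain ⟨φ, hφ⟩ := (Module.Baer.of_divisible ℚ).extension_property_addMonoidHom
    ((zmultiplesHom E) e) hinj (Int.castAddHom ℚ)
  have h1 : φ e = 1 := by simpa using DFunLike.congr_fun hφ 1
  exact one_ne_zero (h1.symm.trans (h φ))

theorem exists_addMonoidHom_forall_pos {E : Type*} [AddCommGroup E] {T : Set E} (hT : T.Finite)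
    (h : ∀ a ∈ T, -a ∉ AddSubmonoid.closure T) : ∃ φ : E →+ ℚ, ∀ a ∈ T, 0 < φ a := by
  let ev : E →+ Module.Dual ℚ (E →+ ℚ) :=
    { toFun e := (AddMonoidHom.eval e).toRatLinearMap
      map_zero' := by ext φ; exact map_zero φ
      map_add' d e := by ext φ; exact map_add φ d e }
  have exists_pos : ∀ t ∈ T, ∃ φ : E →+ ℚ, (∀ a ∈ T, 0 ≤ φ a) ∧ 0 < φ t := by
    intro t ht
    by_contra! hneg
    have hmem : -ev t ∈ PointedCone.hull ℚ (ev '' T) := by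
      have := mem_hull_image_of_forall_nonneg (s := hT.toFinset) (a := ev) (b := -ev t)
        fun φ hφ => neg_nonneg.2 (hneg φ fun a ha => hφ a (hT.mem_toFinset.2 ha))
      rwa [hT.coe_toFinset] at this
    obtain ⟨n, hn, e, he, hne⟩ := exists_nsmul_eq_of_mem_hull ev hmem
    have hev : ev (n • t + e) = 0 := by rw [map_add, map_nsmul, ← hne, smul_neg, add_neg_cancel]
    obtain ⟨k, hk, hke⟩ := isOfFinAddOrder_iff_nsmul_eq_zero.1 <|
      isOfFinAddOrder_of_forall_addMonoidHom_eq_zero fun φ => LinearMap.congr_fun hev φ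
    obtain ⟨l, hl⟩ : ∃ l, k * n = l + 1 := Nat.exists_eq_add_one.2 (Nat.mul_pos hk hn)
    have hneg_t : -t = l • t + k • e := by
      rw [neg_eq_iff_add_eq_zero, ← hke, nsmul_add, smul_smul, hl, succ_nsmul']
      abel
    exact h t ht (hneg_t ▸ add_mem (nsmul_mem (AddSubmonoid.subset_closure ht) l)
      (nsmul_mem he k))
  choose! φ hφ hpos using exists_pos
  refine ⟨∑ t ∈ hT.toFinset, φ t, fun a ha => ?_⟩
  rw [AddMonoidHom.finsetSum_apply]
  exact Finset.sum_pos' (fun t ht => hφ t (hT.mem_toFinset.1 ht) a ha)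
    ⟨a, hT.mem_toFinset.2 ha, hpos a ha⟩

section Amalgam

variable {ι G₀ : Type*} [AddCommGroup G₀] {G : ι → Type*} [∀ i, AddCommGroup (G i)]

section Fintype

variable [Fintype ι]

/-- The subgroup of `∀ i, G i` by which one has to divide in order to identify the images of `G₀`
under all the homomorphisms `e i`. -/
def amalgamSubgroup (e : ∀ i, G₀ →+ G i) : AddSubgroup (∀ i, G i) where
  carrier := {x | ∃ z : ι → G₀, ∑ i, z i = 0 ∧ ∀ i, e i (z i) = x i}
  zero_mem' := ⟨0, by simp⟩
  add_mem' := by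
    rintro x y ⟨z, hz, hx⟩ ⟨w, hw, hy⟩
    exact ⟨z + w, by simp [Finset.sum_add_distrib, hz, hw], by simp [hx, hy]⟩
  neg_mem' := by
    rintro x ⟨z, hz, hx⟩
    exact ⟨-z, by simp [hz], by simp [hx]⟩

theorem single_sub_single_mem_amalgamSubgroup [DecidableEq ι] (e : ∀ i, G₀ →+ G i) (i j : ι)
    (g : G₀) :
    Pi.single (M := G) i (e i g) - Pi.single j (e j g) ∈ amalgamSubgroup e := by
  refine ⟨Pi.single i g - Pi.single j g, by simp, fun k => ?_⟩
  rw [Pi.sub_apply, Pi.sub_apply, map_sub, Pi.apply_single (fun k => e k) fun k => map_zero (e k),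
    Pi.apply_single (fun k => e k) fun k => map_zero (e k)]

theorem eq_zero_of_nonneg_of_mem_amalgamSubgroup [LinearOrder G₀] [IsOrderedAddMonoid G₀]
    [∀ i, LinearOrder (G i)] {e : ∀ i, G₀ →+ G i} (he : ∀ i, StrictMono (e i)) {x : ∀ i, G i}
    (hx : 0 ≤ x) (hmem : x ∈ amalgamSubgroup e) : x = 0 := by
  obtain ⟨z, hz, hzx⟩ := hmem
  have hz_nonneg (i : ι) : 0 ≤ z i := by
    rw [← (he i).le_iff_le, map_zero, hzx]
    exact hx i
  have hz_zero := (Finset.sum_eq_zero_iff_of_nonneg fun i _ => hz_nonneg i).1 hz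
  ext i
  rw [← hzx, hz_zero i (Finset.mem_univ i), map_zero, Pi.zero_apply]

end Fintype

theorem exists_compatible_addMonoidHom_forall_pos [Finite ι] [LinearOrder G₀]
    [IsOrderedAddMonoid G₀] [∀ i, LinearOrder (G i)] [∀ i, IsOrderedAddMonoid (G i)]
    {e : ∀ i, G₀ →+ G i} (he : ∀ i, StrictMono (e i))
    {P : ∀ i, Set (G i)} (hP : ∀ i, (P i).Finite) (hpos : ∀ i, ∀ a ∈ P i, 0 < a) :
    ∃ φ : ∀ i, G i →+ ℚ, (∀ i j g, φ i (e i g) = φ j (e j g)) ∧ ∀ i, ∀ a ∈ P i, 0 < φ i a := by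
  classical
  cases nonempty_fintype ι
  let π := QuotientAddGroup.mk' (amalgamSubgroup e)
  let T : Set ((∀ i, G i) ⧸ amalgamSubgroup e) := ⋃ i, (fun a => π (Pi.single i a)) '' P i
  have closure_le : AddSubmonoid.closure T ≤ (AddSubmonoid.nonneg (∀ i, G i)).map π := by
    rw [AddSubmonoid.closure_le]
    refine Set.iUnion_subset fun i => ?_
    rintro _ ⟨a, ha, rfl⟩
    exact ⟨_, Pi.single_nonneg.2 (hpos i a ha).le, rfl⟩
  obtain ⟨φ, hφ⟩ := exists_addMonoidHom_forall_pos
    (Set.finite_iUnion fun i => (hP i).image fun a => π (Pi.single i a)) (T := T) <| by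
      intro t ht hneg
      obtain ⟨i, a, ha, rfl⟩ := Set.mem_iUnion.1 ht
      obtain ⟨x, hx, hxa⟩ := closure_le hneg
      have hmem : x + Pi.single i a ∈ amalgamSubgroup e := by
        rw [← QuotientAddGroup.eq_zero_iff]
        exact eq_neg_iff_add_eq_zero.1 hxa
      have hzero := eq_zero_of_nonneg_of_mem_amalgamSubgroup he
        (add_nonneg hx (Pi.single_nonneg.2 (hpos i a ha).le)) hmem
      have hi := congrFun hzero i
      rw [Pi.add_apply, Pi.single_eq_same] at hi
      exact (add_pos_of_nonneg_of_pos (hx i) (hpos i a ha)).ne' hi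
  refine ⟨fun i => (φ.comp π).comp (AddMonoidHom.single G i), fun i j g => ?_, fun i a ha =>
    hφ _ (Set.mem_iUnion.2 ⟨i, a, ha, rfl⟩)⟩
  refine congrArg φ ?_
  rw [← sub_eq_zero]
  exact (QuotientAddGroup.eq_zero_iff _).2 (single_sub_single_mem_amalgamSubgroup e i j g)

end Amalgam

theorem exists_pos_forall_nat_mul_eq_int {F : Set ℚ} (hF : F.Finite) :
    ∃ N : ℕ, 0 < N ∧ ∀ q ∈ F, ∃ z : ℤ, N * q = z := by
  refine ⟨∏ q ∈ hF.toFinset, q.den, Finset.prod_pos fun q _ => q.den_pos, fun q hq => ?_⟩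
  obtain ⟨n, hn⟩ := Finset.dvd_prod_of_mem Rat.den (hF.mem_toFinset.2 hq)
  refine ⟨n * q.num, ?_⟩
  rw [hn]
  push_cast
  rw [mul_right_comm, Rat.den_mul_eq_num, mul_comm]

namespace MVAlgebra

/-- A map from an MV-chain to the `(m + 1)`-element chain which on `S` preserves the order and
those values of the MV-operations that belong to `S`. -/
structure IsPartialEmbedding {C : Type*} [MVAlgebra C] (S : Set C) {m : ℕ}
    (α : C → Fin (m + 1)) : Prop where
  strictMonoOn : StrictMonoOn α S
  map_zero : α 0 = 0
  map_compl : ∀ a ∈ S, aᶜ ∈ S → α aᶜ = MVOps.neg (α a)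
  map_add : ∀ a ∈ S, ∀ b ∈ S, a + b ∈ S → α (a + b) = MVOps.plus (α a) (α b)

theorem IsPartialEmbedding.mono {C : Type*} [MVAlgebra C] {S T : Set C} {m : ℕ}
    {α : C → Fin (m + 1)} (h : IsPartialEmbedding T α) (hST : S ⊆ T) : IsPartialEmbedding S α where
  strictMonoOn := h.strictMonoOn.mono hST
  map_zero := h.map_zero
  map_compl a ha hac := h.map_compl a (hST ha) (hST hac)
  map_add a ha b hb hab := h.map_add a (hST ha) b (hST hb) (hST hab)

section PartialEmbedding

open ChangGroup

open scoped Pointwise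

theorem cast_clamp_floor {q : ℚ} {m : ℕ} (hq : 0 ≤ q) (hqm : q ≤ m) (hint : ∃ z : ℤ, q = z) :
    ((Fin.clamp ⌊q⌋₊ m : ℕ) : ℚ) = q := by
  obtain ⟨z, rfl⟩ := hint
  lift z to ℕ using by exact_mod_cast hq
  simpa using hqm

section

variable {C : Type*} [MVAlgebra C] [IsMVChain C] {S : Set C} {ν : ChangGroup C →+ ℚ} {m : ℕ}

theorem of_mem_image_add_image (hzero : 0 ∈ S) {a : C} (ha : a ∈ S) :
    of a ∈ of '' S + of '' S :=
  ⟨of a, ⟨a, ha, rfl⟩, of 0, ⟨0, hzero, rfl⟩, by rw [of_zero]; exact add_zero _⟩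

theorem isPartialEmbedding_of_cast_eq {α : C → Fin (m + 1)} (hm : ν (of ⊤) = m) (hzero : 0 ∈ S)
    (htop : ⊤ ∈ S) (hν : StrictMonoOn ν (of '' S + of '' S))
    (hα : ∀ a ∈ S, ((α a : ℕ) : ℚ) = ν (of a)) : IsPartialEmbedding S α := by
  refine ⟨fun a ha b hb hab => ?_, ?_, fun a ha hac => ?_, fun a ha b hb hadd => ?_⟩
  · have hlt := hν (of_mem_image_add_image hzero ha) (of_mem_image_add_image hzero hb)
      (of_strictMono hab)
    rw [← hα a ha, ← hα b hb] at hlt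
    exact_mod_cast hlt
  · have hcast := hα 0 hzero
    rw [of_zero, map_zero] at hcast
    exact Fin.ext (Nat.cast_eq_zero.1 hcast)
  · have hcast := hα _ hac
    rw [of_compl, map_sub, hm, ← hα a ha, eq_sub_iff_add_eq] at hcast
    ext
    exact Nat.eq_sub_of_add_eq (by exact_mod_cast hcast)
  · have hmin : ν (min (of ⊤) (of a + of b)) = min (ν (of ⊤)) (ν (of a) + ν (of b)) := by
      rw [← map_add]
      exact hν.monotoneOn.map_min (of_mem_image_add_image hzero htop)
        (Set.add_mem_add ⟨a, ha, rfl⟩ ⟨b, hb, rfl⟩)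
    have hcast := hα _ hadd
    rw [of_add, hmin, hm, ← hα a ha, ← hα b hb] at hcast
    ext
    change (α (a + b) : ℕ) = min m (α a + α b)
    exact_mod_cast hcast

theorem isPartialEmbedding_clamp_floor (hm : ν (of ⊤) = m) (hzero : 0 ∈ S) (htop : ⊤ ∈ S)
    (hν : StrictMonoOn ν (of '' S + of '' S)) (hint : ∀ a ∈ S, ∃ z : ℤ, ν (of a) = z) :
    IsPartialEmbedding S fun a => Fin.clamp ⌊ν (of a)⌋₊ m := by
  have hmono {a b : C} (ha : a ∈ S) (hb : b ∈ S) (hab : a ≤ b) : ν (of a) ≤ ν (of b) :=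
    hν.monotoneOn (of_mem_image_add_image hzero ha) (of_mem_image_add_image hzero hb)
      (of_le_of.2 hab)
  refine isPartialEmbedding_of_cast_eq hm hzero htop hν fun a ha =>
    cast_clamp_floor ?_ ?_ (hint a ha)
  · simpa using hmono hzero ha zero_le
  · simpa [hm] using hmono ha htop le_top

end

theorem exists_compatible_isPartialEmbedding {ι C₀ : Type*} [Finite ι] [Nonempty ι] [MVAlgebra C₀]
    [IsMVChain C₀] {C : ι → Type*} [∀ i, MVAlgebra (C i)] [∀ i, IsMVChain (C i)]
    {f : ∀ i, C₀ → C i} (hf : ∀ i, IsHom (f i)) (hinj : ∀ i, Function.Injective (f i))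
    {S : ∀ i, Set (C i)} (hS : ∀ i, (S i).Finite) (hzero : ∀ i, 0 ∈ S i) (htop : ∀ i, ⊤ ∈ S i) :
    ∃ m : ℕ, 0 < m ∧ ∃ α : ∀ i, C i → Fin (m + 1),
      (∀ i, IsPartialEmbedding (S i) (α i)) ∧ ∀ i j c, α i (f i c) = α j (f j c) := by
  let R (i : ι) : Set (ChangGroup (C i)) := of '' S i + of '' S i
  have hR (i : ι) : (R i).Finite := ((hS i).image of).add ((hS i).image of)
  obtain ⟨φ, hφ, hpos⟩ := exists_compatible_addMonoidHom_forall_pos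
    (fun i => ChangGroup.map_strictMono (hf i) (hinj i))
    (P := fun i => {d ∈ R i - R i | 0 < d}) (fun i => ((hR i).sub (hR i)).subset fun _ h => h.1)
    fun _ _ h => h.2
  have hφ_of (i j : ι) (c : C₀) : φ i (of (f i c)) = φ j (of (f j c)) := by
    rw [← ChangGroup.map_of (hf i) (hinj i), ← ChangGroup.map_of (hf j) (hinj j)]
    exact hφ i j _
  obtain ⟨N, hN, hNint⟩ := exists_pos_forall_nat_mul_eq_int
    (Set.finite_iUnion fun i => (hS i).image fun a => φ i (of a))
  have hint (i : ι) (a : C i) (ha : a ∈ S i) : ∃ z : ℤ, N * φ i (of a) = z :=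
    hNint _ (Set.mem_iUnion.2 ⟨i, a, ha, rfl⟩)
  let ν (i : ι) : ChangGroup (C i) →+ ℚ := (AddMonoidHom.mulLeft (N : ℚ)).comp (φ i)
  have hν (i : ι) : StrictMonoOn (ν i) (R i) := fun x hx y hy hxy =>
    mul_lt_mul_of_pos_left (sub_pos.1 (map_sub (φ i) y x ▸
      hpos i _ ⟨Set.sub_mem_sub hy hx, sub_pos.2 hxy⟩)) (Nat.cast_pos.2 hN)
  obtain ⟨i₀⟩ := ‹Nonempty ι›
  obtain ⟨z, hz⟩ := hint i₀ ⊤ (htop i₀)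
  have hpos_top : 0 < ν i₀ (of ⊤) := by
    rw [← map_zero (ν i₀), ← of_zero]
    exact hν i₀ (of_mem_image_add_image (hzero i₀) (hzero i₀))
      (of_mem_image_add_image (hzero i₀) (htop i₀)) (of_zero (C := C i₀) ▸ of_top_pos)
  have hz_pos : (0 : ℚ) < z := hz ▸ hpos_top
  lift z to ℕ using by exact_mod_cast hz_pos.le
  have hν_top (i : ι) : ν i (of ⊤) = z := by
    have htop_eq := hφ_of i i₀ ⊤
    rw [(hf i).map_top, (hf i₀).map_top] at htop_eq
    exact (congrArg ((N : ℚ) * ·) htop_eq).trans hz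
  refine ⟨z, by exact_mod_cast hz_pos, fun i a => Fin.clamp ⌊ν i (of a)⌋₊ z, fun i =>
    isPartialEmbedding_clamp_floor (hν_top i) (hzero i) (htop i) (hν i) (hint i), fun i j c => ?_⟩
  simp only [ν, AddMonoidHom.comp_apply, hφ_of i j c]

end PartialEmbedding

end MVAlgebra

open MVAlgebra

/-- MV-algebras with two quantifiers that satisfy the axioms (M1), (M2), (M3) and (M5) of monadic
MV-algebras, with `x → y` written as `xᶜ + y` and `x * x` as `(xᶜ + xᶜ)ᶜ`. -/
class QuantifiedMVAlgebra (A : Type*) extends MVAlgebra A where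
  /-- The existential quantifier. -/
  ex : A → A
  /-- The universal quantifier. -/
  all : A → A
  all_le : ∀ x : A, all x ≤ x
  all_compl_add_all : ∀ x y : A, all (xᶜ + all y) = (ex x)ᶜ + all y
  all_compl_all_add : ∀ x y : A, all ((all x)ᶜ + y) = (all x)ᶜ + all y
  ex_compl_add_compl : ∀ x : A, ex (xᶜ + xᶜ)ᶜ = ((ex x)ᶜ + (ex x)ᶜ)ᶜ

namespace QuantifiedMVAlgebra

section Quantifiers

variable {A : Type*} [QuantifiedMVAlgebra A]

theorem all_zero : all (0 : A) = 0 := nonpos_iff_eq_zero.1 (all_le 0)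

theorem all_compl (x : A) : all xᶜ = (ex x)ᶜ := by
  have h := all_compl_add_all x 0
  rwa [all_zero, add_zero, add_zero] at h

theorem ex_eq_compl_all_compl (x : A) : ex x = (all xᶜ)ᶜ := by
  rw [all_compl, MVAlgebra.compl_compl]

theorem le_ex (x : A) : x ≤ ex x := by
  rw [← MVAlgebra.compl_le_compl_iff, ← all_compl]
  exact all_le _

theorem all_top : all (⊤ : A) = ⊤ := by
  simpa [all_zero] using all_compl_all_add (0 : A) 0

theorem all_all (x : A) : all (all x) = all x := by
  have h := all_compl_add_all (⊤ : A) x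
  rwa [top_le_iff.1 (le_ex (⊤ : A)), MVAlgebra.compl_top, zero_add] at h

theorem ex_all (x : A) : ex (all x) = all x := by
  refine le_antisymm ?_ (le_ex _)
  have h := all_compl_add_all (all x) x
  rw [compl_add_self, all_top] at h
  exact le_iff_compl_add_eq_top.2 h.symm

theorem all_mono {x y : A} (h : x ≤ y) : all x ≤ all y := by
  have h' := all_compl_all_add x y
  rw [le_iff_compl_add_eq_top.1 ((all_le x).trans h), all_top] at h'
  exact le_iff_compl_add_eq_top.2 h'.symm

theorem all_ex (x : A) : all (ex x) = ex x := by
  rw [ex_eq_compl_all_compl, all_compl, ex_all]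

theorem all_add_self (x : A) : all (x + x) = all x + all x := by
  have h := ex_compl_add_compl xᶜ
  simp only [ex_eq_compl_all_compl, MVAlgebra.compl_compl] at h
  simpa using congrArg compl h

theorem all_compl_of_all_eq {x : A} (hx : all x = x) : all xᶜ = xᶜ := by
  rw [all_compl, ← hx, ex_all]

theorem all_add_of_all_eq {x y : A} (hx : all x = x) (hy : all y = y) :
    all (x + y) = x + y := by
  have h := all_compl_all_add xᶜ y
  rwa [all_compl_of_all_eq hx, MVAlgebra.compl_compl, hy] at h

theorem all_sub_of_all_eq {x y : A} (hx : all x = x) (hy : all y = y) :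
    all (x - y) = x - y :=
  all_compl_of_all_eq (all_add_of_all_eq (all_compl_of_all_eq hx) hy)

theorem ex_le_of_le_of_all_eq {x b : A} (hb : all b = b) (h : x ≤ b) : ex x ≤ b := by
  rw [ex_eq_compl_all_compl, ← MVAlgebra.compl_le_compl_iff, MVAlgebra.compl_compl,
    ← all_compl_of_all_eq hb]
  exact all_mono (MVAlgebra.compl_le_compl_iff.2 h)

/- A constant `m` below `ex t - t` satisfies `t ≤ ex t - m`, hence `ex t ≤ ex t - m`. -/
theorem all_ex_sub_self (t : A) : all (ex t - t) = 0 := by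
  set m := all (ex t - t)
  have hm : all m = m := all_all _
  have hle : m ≤ ex t - t := all_le _
  have htm : t ≤ mᶜ := by
    rw [← MVAlgebra.compl_le_compl_iff, MVAlgebra.compl_compl]
    exact hle.trans (by rw [← compl_sub_compl]; exact tsub_le_self)
  have ht : t ≤ ex t - m :=
    calc t = t + m - m := (add_sub_cancel_of_le htm).symm
      _ ≤ ex t - t + t - m := by rw [add_comm t]; gcongr
      _ = ex t - m := by rw [sub_add_of_le (le_ex t)]
  have hex : ex t ≤ ex t - m := ex_le_of_le_of_all_eq (all_sub_of_all_eq (all_ex t) hm) ht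
  rw [← nonpos_iff_eq_zero]
  calc m ≤ ex t ⊓ m := le_inf (hle.trans tsub_le_self) le_rfl
    _ = ex t - (ex t - m) := inf_def _ _
    _ = 0 := le_iff_sub_eq_zero.1 hex

theorem all_nsmul_eq_zero {w : A} (hw : all w = 0) (n : ℕ) : all (n • w) = 0 := by
  have hpow (k : ℕ) : all (2 ^ k • w) = 0 := by
    induction k with
    | zero => rwa [pow_zero, one_nsmul]
    | succ k ih => rw [pow_succ, mul_two, add_nsmul, all_add_self, ih, add_zero]
  rw [← nonpos_iff_eq_zero, ← hpow n]
  exact all_mono (nsmul_le_nsmul_left zero_le Nat.lt_two_pow_self.le)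

end Quantifiers

/-- The MV-algebra of the elements that are fixed by the quantifiers. -/
@[ext]
structure Fixed (A : Type*) [QuantifiedMVAlgebra A] where
  /-- The underlying element. -/
  val : A
  all_val : all val = val

namespace Fixed

variable {A : Type*} [QuantifiedMVAlgebra A]

instance : Zero (Fixed A) := ⟨⟨0, all_zero⟩⟩

instance : Add (Fixed A) := ⟨fun x y => ⟨x.val + y.val, all_add_of_all_eq x.2 y.2⟩⟩

instance : MVAlgebra (Fixed A) where
  add_assoc _ _ _ := Fixed.ext (add_assoc _ _ _)
  zero_add _ := Fixed.ext (zero_add _)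
  add_zero _ := Fixed.ext (add_zero _)
  nsmul := nsmulRec
  add_comm _ _ := Fixed.ext (add_comm _ _)
  compl x := ⟨x.valᶜ, all_compl_of_all_eq x.2⟩
  compl_compl _ := Fixed.ext (MVAlgebra.compl_compl _)
  add_compl_zero _ := Fixed.ext (add_compl_zero _)
  lukasiewicz _ _ := Fixed.ext (lukasiewicz _ _)

theorem isHom_val : IsHom (val : Fixed A → A) := ⟨rfl, fun _ _ => rfl, fun _ => rfl⟩

theorem val_le_val {x y : Fixed A} : x.val ≤ y.val ↔ x ≤ y := by
  rw [le_iff_sub_eq_zero, le_iff_sub_eq_zero, ← isHom_val.map_sub]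
  exact (Fixed.ext_iff (y := 0)).symm

end Fixed

section PrimeIdeals

variable {A : Type*} [QuantifiedMVAlgebra A]

theorem exists_isPrimeIdeal_ex_sub_mem {J : Set (Fixed A)} (hJ : IsPrimeIdeal J) (t : A) :
    ∃ I : Set A, IsPrimeIdeal I ∧ (∀ b : Fixed A, b.val ∈ I ↔ b ∈ J) ∧ ex t - t ∈ I := by
  have hdisj : Disjoint {z | ∃ q ∈ J, ∃ n : ℕ, z ≤ q.val + n • (ex t - t)} (Fixed.val '' Jᶜ) := by
    rw [Set.disjoint_left]
    rintro _ ⟨q, hq, n, h⟩ ⟨b, hb, rfl⟩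
    refine hb (hJ.mem_of_le (Fixed.val_le_val.1 (le_iff_sub_eq_zero.2 ?_)) hq)
    have hall : all (b.val - q.val) ≤ all (n • (ex t - t)) := all_mono (tsub_le_iff_left.2 h)
    rwa [all_nsmul_eq_zero (all_ex_sub_self t), all_sub_of_all_eq b.2 q.2,
      nonpos_iff_eq_zero] at hall
  have hinf : InfClosed (Fixed.val '' Jᶜ) := by
    rintro _ ⟨x, hx, rfl⟩ _ ⟨y, hy, rfl⟩
    exact ⟨x ⊓ y, fun h => (hJ.mem_or_mem h).elim hx hy, rfl⟩
  obtain ⟨I, hI, hsub, hdisj⟩ := exists_isPrimeIdeal_of_disjoint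
    (hJ.image_add_nsmul Fixed.isHom_val (ex t - t)) (Set.Nonempty.image _ ⟨⊤, hJ.top_notMem⟩) hinf
    hdisj
  refine ⟨I, hI, fun b => ⟨fun h => ?_, fun h => hsub ⟨b, h, 0, by simp⟩⟩,
    hsub ⟨0, hJ.zero_mem, 1, by simp⟩⟩
  by_contra hb
  exact Set.disjoint_left.1 hdisj h ⟨b, hb, rfl⟩

theorem exists_compatible_isPartialEmbedding_quotient {ι : Type*} [Finite ι] [Nonempty ι]
    {J : Set (Fixed A)} (hJ : IsPrimeIdeal J) {I : ι → Set A} (hI : ∀ i, IsPrimeIdeal (I i))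
    (hIJ : ∀ i, ∀ b : Fixed A, b.val ∈ I i ↔ b ∈ J) {S : Set A} (hS : S.Finite) :
    ∃ m : ℕ, 0 < m ∧ ∃ α : ∀ i, (hI i).addCon.Quotient → Fin (m + 1),
      (∀ i, IsPartialEmbedding ((↑) '' S) (α i)) ∧ ∀ i j (b : Fixed A), α i b.val = α j b.val := by
  have hchain (i : ι) : IsMVChain (hI i).addCon.Quotient := (hI i).isMVChain
  have hchain₀ : IsMVChain hJ.addCon.Quotient := hJ.isMVChain
  obtain ⟨m, hm, α, hα, hcompat⟩ := exists_compatible_isPartialEmbedding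
    (fun i => Fixed.isHom_val.isHom_quotientMap (hI i).toIsIdeal hJ.toIsIdeal (hIJ i))
    (fun i => Fixed.isHom_val.quotientMap_injective (hI i).toIsIdeal hJ.toIsIdeal (hIJ i))
    (S := fun i => (↑) '' insert 0 (insert ⊤ S)) (fun i => ((hS.insert ⊤).insert 0).image _)
    (fun i => ⟨0, by simp, rfl⟩) (fun i => ⟨⊤, by simp, rfl⟩)
  refine ⟨m, hm, α, fun i => (hα i).mono (Set.image_mono ?_), fun i j b => hcompat i j b⟩
  exact (Set.subset_insert _ _).trans (Set.subset_insert _ _)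

end PrimeIdeals

/-- A map that preserves those values of the operations of a quantified MV-algebra `A`, taken on
`S`, that belong to `S`, where the quantifiers on `ι → Fin (m + 1)` are the constant functions with
values supremum and infimum. -/
structure IsPartialHom {A : Type*} [QuantifiedMVAlgebra A] (S : Set A) {m : ℕ} {ι : Type*}
    (φ : A → ι → Fin (m + 1)) : Prop where
  map_zero : ∀ i, φ 0 i = 0
  map_compl : ∀ a ∈ S, aᶜ ∈ S → ∀ i, φ aᶜ i = MVOps.neg (φ a i)
  map_add : ∀ a ∈ S, ∀ b ∈ S, a + b ∈ S → ∀ i, φ (a + b) i = MVOps.plus (φ a i) (φ b i)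
  map_ex : ∀ a ∈ S, ex a ∈ S → ∀ j, φ (ex a) j = ⨆ i, φ a i
  map_all : ∀ a ∈ S, all a ∈ S → ∀ j, φ (all a) j = ⨅ i, φ a i

end QuantifiedMVAlgebra

theorem eq_iSup_of_forall_le_of_exists_eq {ι α : Type*} [CompleteLattice α] {f g : ι → α}
    (hg : ∀ i j, g i = g j) (hle : ∀ i, f i ≤ g i) (heq : ∃ i, f i = g i) (j : ι) :
    g j = ⨆ i, f i := by
  obtain ⟨i, hi⟩ := heq
  exact le_antisymm (((hg j i).trans hi.symm).trans_le (le_iSup f i))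
    (iSup_le fun k => (hle k).trans_eq (hg k j))

theorem eq_iInf_of_forall_le_of_exists_eq {ι α : Type*} [CompleteLattice α] {f g : ι → α}
    (hg : ∀ i j, g i = g j) (hle : ∀ i, g i ≤ f i) (heq : ∃ i, f i = g i) (j : ι) :
    g j = ⨅ i, f i :=
  eq_iSup_of_forall_le_of_exists_eq (α := αᵒᵈ) hg hle heq j

namespace QuantifiedMVAlgebra

section PartialHom

variable {A : Type*} [QuantifiedMVAlgebra A]

theorem isPartialHom_of_isPartialEmbedding {ι : Type*} {I : ι → Set A}
    (hI : ∀ i, IsPrimeIdeal (I i)) {S : Set A} {m : ℕ}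
    {α : ∀ i, (hI i).addCon.Quotient → Fin (m + 1)}
    (hα : ∀ i, IsPartialEmbedding ((↑) '' S) (α i))
    (hcompat : ∀ i j (b : Fixed A), α i b.val = α j b.val)
    (hex : ∀ a ∈ S, ∃ i, ex a - a ∈ I i) (hall : ∀ a ∈ S, ∃ i, a - all a ∈ I i) :
    IsPartialHom S fun a i => α i a := by
  have le_of_sub_mem {i : ι} {a b : A} (ha : a ∈ S) (hb : b ∈ S) (h : a - b ∈ I i) :
      α i a ≤ α i b :=
    (hα i).strictMonoOn.monotoneOn ⟨a, ha, rfl⟩ ⟨b, hb, rfl⟩ ((hI i).mk_le_mk.2 h)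
  have le_of_le {i : ι} {a b : A} (ha : a ∈ S) (hb : b ∈ S) (h : a ≤ b) : α i a ≤ α i b :=
    le_of_sub_mem ha hb (le_iff_sub_eq_zero.1 h ▸ (hI i).zero_mem)
  constructor
  · exact fun i => (hα i).map_zero
  · exact fun a ha hac i => (hα i).map_compl _ ⟨a, ha, rfl⟩ ⟨_, hac, rfl⟩
  · exact fun a ha b hb hab i => (hα i).map_add _ ⟨a, ha, rfl⟩ _ ⟨b, hb, rfl⟩ ⟨_, hab, rfl⟩
  · intro a ha hea
    obtain ⟨i, hi⟩ := hex a ha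
    exact eq_iSup_of_forall_le_of_exists_eq (fun i j => hcompat i j ⟨ex a, all_ex a⟩)
      (fun _ => le_of_le ha hea (le_ex a))
      ⟨i, (le_of_le ha hea (le_ex a)).antisymm (le_of_sub_mem hea ha hi)⟩
  · intro a ha haa
    obtain ⟨i, hi⟩ := hall a ha
    exact eq_iInf_of_forall_le_of_exists_eq (fun i j => hcompat i j ⟨all a, all_all a⟩)
      (fun _ => le_of_le haa ha (all_le a))
      ⟨i, (le_of_sub_mem ha haa hi).antisymm (le_of_le haa ha (all_le a))⟩

end PartialHom

section Separation

variable {A : Type u} [QuantifiedMVAlgebra A] {S : Set A} {x y : A}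

theorem exists_isPartialHom_of_not_le (hS : S.Finite) (hx : x ∈ S) (hy : y ∈ S) (hxy : ¬ x ≤ y) :
    ∃ (ι : Type u) (_ : Finite ι) (_ : Nonempty ι) (m : ℕ) (φ : A → ι → Fin (m + 1)),
      0 < m ∧ IsPartialHom S φ ∧ φ x ≠ φ y := by
  have hne : (⟨ex (x - y), all_ex _⟩ : Fixed A) ≠ 0 := fun h =>
    hxy (nonpos_iff_eq_zero.1 ((le_ex _).trans_eq (congrArg Fixed.val h)))
  obtain ⟨J, hJ, hJxy⟩ := exists_isPrimeIdeal_notMem hne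
  choose I hI hIJ hex using exists_isPrimeIdeal_ex_sub_mem hJ
  have hall (a : A) : a - all a ∈ I aᶜ := by
    have h := hex aᶜ
    rwa [ex_eq_compl_all_compl, MVAlgebra.compl_compl, compl_sub_compl] at h
  have hxyI : x - y ∉ I (x - y) := fun h =>
    hJxy ((hIJ (x - y) _).1 ((hI _).mem_of_le (sub_add_of_le (le_ex _)).ge
      ((hI _).add_mem (hex _) h)))
  let W : Set A := insert (x - y) (S ∪ compl '' S)
  have hW : Finite W := ((hS.union (hS.image compl)).insert (x - y)).to_subtype
  let i₀ : W := ⟨x - y, Set.mem_insert _ _⟩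
  have hW_nonempty : Nonempty W := ⟨i₀⟩
  obtain ⟨m, hm, α, hα, hcompat⟩ := exists_compatible_isPartialEmbedding_quotient hJ
    (fun i : W => hI i) (fun i => hIJ i) hS
  have hlt : α i₀ y < α i₀ x := (hα i₀).strictMonoOn ⟨y, hy, rfl⟩ ⟨x, hx, rfl⟩ <|
    lt_of_le_not_ge ((hI _).mk_le_mk.2 (((hI _).sub_mem_or_sub_mem x y).resolve_left hxyI))
      (mt (hI _).mk_le_mk.1 hxyI)
  refine ⟨W, hW, hW_nonempty, m, fun a i => α i a, hm,
    isPartialHom_of_isPartialEmbedding (fun i : W => hI i) hα hcompat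
      (fun a ha => ⟨⟨a, Or.inr (Or.inl ha)⟩, hex a⟩)
      (fun a ha => ⟨⟨aᶜ, Or.inr (Or.inr ⟨a, ha, rfl⟩)⟩, hall a⟩), fun h => hlt.ne' (congrFun h i₀)⟩

theorem exists_isPartialHom_of_ne (hS : S.Finite) (hx : x ∈ S) (hy : y ∈ S) (hxy : x ≠ y) :
    ∃ (ι : Type u) (_ : Finite ι) (_ : Nonempty ι) (m : ℕ) (φ : A → ι → Fin (m + 1)),
      0 < m ∧ IsPartialHom S φ ∧ φ x ≠ φ y := by
  by_cases hle : x ≤ y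
  · obtain ⟨ι, hfin, hne, m, φ, hm, hφ, h⟩ :=
      exists_isPartialHom_of_not_le hS hy hx fun hle' => hxy (hle.antisymm hle')
    exact ⟨ι, hfin, hne, m, φ, hm, hφ, h.symm⟩
  · exact exists_isPartialHom_of_not_le hS hx hy hle

end Separation

end QuantifiedMVAlgebra

section Terms

variable {L : FirstOrder.Language} {M N α : Type*} [L.Structure M] [L.Structure N]

variable (L) in
/-- The map `φ` respects those values of the operations of `M`, taken on `S`, that belong to `S`. -/
def PreservesFunctionsOn (S : Set M) (φ : M → N) : Prop :=
  ∀ ⦃n : ℕ⦄ (f : L.Functions n) (a : Fin n → M), (∀ i, a i ∈ S) → Structure.funMap f a ∈ S →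
    φ (Structure.funMap f a) = Structure.funMap f (φ ∘ a)

/-- The values of all subterms of a term. -/
def subtermValues (v : α → M) : L.Term α → Set M
  | .var a => {v a}
  | .func f ts => insert (Structure.funMap f fun i => (ts i).realize v)
      (⋃ i, subtermValues v (ts i))

theorem finite_subtermValues (v : α → M) (t : L.Term α) : (subtermValues v t).Finite := by
  induction t with
  | var a => exact Set.finite_singleton _
  | func f ts ih => exact (Set.finite_iUnion ih).insert _

theorem realize_mem_subtermValues (v : α → M) (t : L.Term α) :
    t.realize v ∈ subtermValues v t := by
  cases t with
  | var a => exact rfl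
  | func f ts => exact Set.mem_insert _ _

theorem PreservesFunctionsOn.map_realize {S : Set M} {φ : M → N}
    (hφ : PreservesFunctionsOn L S φ) {v : α → M} {t : L.Term α} (ht : subtermValues v t ⊆ S) :
    φ (t.realize v) = t.realize (φ ∘ v) := by
  induction t with
  | var a => rfl
  | func f ts ih =>
    obtain ⟨hf, hts⟩ := Set.insert_subset_iff.1 ht
    replace hts := Set.iUnion_subset_iff.1 hts
    calc φ ((Term.func f ts).realize v)
        = Structure.funMap f fun i => φ ((ts i).realize v) :=
          hφ f _ (fun i => hts i (realize_mem_subtermValues v (ts i))) hf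
      _ = (Term.func f ts).realize (φ ∘ v) := congrArg _ (funext fun i => ih i (hts i))

end Terms

namespace QuasiIdentity

variable {q : QuasiIdentity} {A : MonadicMVAlg.{u}}

theorem HoldsIn.of_injective {B : MonadicMVAlg.{w}} (hq : q.HoldsIn B) (φ : A →[monadicMVLang] B)
    (hφ : Function.Injective φ) : q.HoldsIn A := fun v hv => hφ <| by
  simp only [← HomClass.realize_term]
  exact hq (φ ∘ v) fun p hp => by simp only [HomClass.realize_term, hv p hp]

theorem exists_finite_not_holdsIn_of_preservesFunctionsOn (hq : ¬ q.HoldsIn A) :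
    ∃ S : Set A, S.Finite ∧ ∃ x ∈ S, ∃ y ∈ S, x ≠ y ∧ ∀ (B : MonadicMVAlg.{w}) (φ : A → B),
      PreservesFunctionsOn monadicMVLang S φ → φ x ≠ φ y → ¬ q.HoldsIn B := by
  simp only [HoldsIn, not_forall] at hq
  obtain ⟨v, hpremises, hne⟩ := hq
  set V : monadicMVLang.Term ℕ × monadicMVLang.Term ℕ → Set A :=
    fun p => subtermValues v p.1 ∪ subtermValues v p.2
  have hV (p) : (V p).Finite := (finite_subtermValues v p.1).union (finite_subtermValues v p.2)
  set S := (⋃ p ∈ q.premises, V p) ∪ V (q.lhs, q.rhs)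
  have hprem {p} (hp : p ∈ q.premises) : subtermValues v p.1 ⊆ S ∧ subtermValues v p.2 ⊆ S :=
    Set.union_subset_iff.1 ((Set.subset_biUnion_of_mem (u := V) hp).trans Set.subset_union_left)
  obtain ⟨hlhs, hrhs⟩ : subtermValues v q.lhs ⊆ S ∧ subtermValues v q.rhs ⊆ S :=
    Set.union_subset_iff.1 Set.subset_union_right
  refine ⟨S, ((List.finite_toSet q.premises).biUnion fun p _ => hV p).union (hV _),
    q.lhs.realize v, hlhs (realize_mem_subtermValues v _), q.rhs.realize v,
    hrhs (realize_mem_subtermValues v _), hne, fun B φ hφ hφne hB => hφne ?_⟩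
  rw [hφ.map_realize hlhs, hφ.map_realize hrhs]
  exact hB (φ ∘ v) fun p hp => by
    rw [← hφ.map_realize (hprem hp).1, ← hφ.map_realize (hprem hp).2, hpremises p hp]

end QuasiIdentity

namespace MonadicMV

variable {A : Type u} [monadicMVLang.Structure A]

theorem funMap_zero (a : Fin 0 → A) :
    Structure.funMap (L := monadicMVLang) MonadicMVFunc.zero a = zero :=
  congrArg _ (Subsingleton.elim _ _)

theorem funMap_neg (a : Fin 1 → A) :
    Structure.funMap (L := monadicMVLang) MonadicMVFunc.neg a = neg (a 0) :=
  congrArg _ (funext fun i => by fin_cases i; rfl)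

theorem funMap_plus (a : Fin 2 → A) :
    Structure.funMap (L := monadicMVLang) MonadicMVFunc.plus a = plus (a 0) (a 1) :=
  congrArg _ (funext fun i => by fin_cases i <;> rfl)

theorem funMap_ex (a : Fin 1 → A) :
    Structure.funMap (L := monadicMVLang) MonadicMVFunc.ex a = ex (a 0) :=
  congrArg _ (funext fun i => by fin_cases i; rfl)

theorem funMap_all (a : Fin 1 → A) :
    Structure.funMap (L := monadicMVLang) MonadicMVFunc.all a = all (a 0) :=
  congrArg _ (funext fun i => by fin_cases i; rfl)

/-- The quantified MV-algebra underlying a monadic MV-algebra. -/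
abbrev IsMonadicMV.toQuantifiedMVAlgebra (h : IsMonadicMV A) : QuantifiedMVAlgebra A where
  zero := zero
  add := plus
  add_assoc x y z := (h.plus_assoc x y z).symm
  add_comm := h.plus_comm
  add_zero := h.plus_zero
  zero_add x := (h.plus_comm _ _).trans (h.plus_zero x)
  nsmul := letI : Zero A := ⟨zero⟩; letI : Add A := ⟨plus⟩; nsmulRec
  nsmul_zero _ := rfl
  nsmul_succ _ _ := rfl
  compl := neg
  compl_compl := h.neg_neg
  add_compl_zero := h.plus_one
  lukasiewicz := h.lukasiewicz
  ex := ex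
  all := all
  all_le x := (congrArg neg (h.m1 x)).trans (h.neg_neg _)
  all_compl_add_all := h.m2
  all_compl_all_add := h.m3
  ex_compl_add_compl := h.m5

theorem IsMonadicMV.preservesFunctionsOn (h : IsMonadicMV A) {S : Set A} {m : ℕ} {ι : Type u}
    {φ : A → functionAlgebra (Fin (m + 1)) ι}
    (hφ : letI := h.toQuantifiedMVAlgebra; QuantifiedMVAlgebra.IsPartialHom S φ) :
    PreservesFunctionsOn monadicMVLang S φ := by
  let _ := h.toQuantifiedMVAlgebra
  intro n f a ha hfa
  cases f with
  | zero => rw [funMap_zero]; exact funext hφ.map_zero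
  | neg => rw [funMap_neg] at hfa ⊢; exact funext (hφ.map_compl _ (ha 0) hfa)
  | plus => rw [funMap_plus] at hfa ⊢; exact funext (hφ.map_add _ (ha 0) _ (ha 1) hfa)
  | ex => rw [funMap_ex] at hfa ⊢; exact funext (hφ.map_ex _ (ha 0) hfa)
  | all => rw [funMap_all] at hfa ⊢; exact funext (hφ.map_all _ (ha 0) hfa)

end MonadicMV

theorem QuasiIdentity.exists_finite_not_holdsIn_functionAlgebra {q : QuasiIdentity}
    {A : MonadicMVAlg.{u}} (hA : A ∈ MMV) (hq : ¬ q.HoldsIn A) :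
    ∃ (ι : Type u) (_ : Finite ι) (_ : Nonempty ι) (m : ℕ),
      0 < m ∧ ¬ q.HoldsIn (functionAlgebra (Fin (m + 1)) ι) := by
  let _ : QuantifiedMVAlgebra A := MonadicMV.IsMonadicMV.toQuantifiedMVAlgebra hA
  obtain ⟨S, hS, x, hx, y, hy, hxy, hfail⟩ :=
    exists_finite_not_holdsIn_of_preservesFunctionsOn hq
  obtain ⟨ι, hfin, hne, m, φ, hm, hφ, hφxy⟩ :=
    QuantifiedMVAlgebra.exists_isPartialHom_of_ne hS hx hy hxy
  exact ⟨ι, hfin, hne, m, hm,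
    hfail (functionAlgebra (Fin (m + 1)) ι) φ
      (MonadicMV.IsMonadicMV.preservesFunctionsOn hA hφ) hφxy⟩

/-- An order embedding of chains that respects the MV-operations. -/
structure IsChainEmbedding {C D : Type} [Preorder C] [MVOps C] [Preorder D] [MVOps D]
    (j : C → D) : Prop where
  strictMono : StrictMono j
  map_zero : j MVOps.zero = MVOps.zero
  map_neg : ∀ a, j (MVOps.neg a) = MVOps.neg (j a)
  map_plus : ∀ a b, j (MVOps.plus a b) = MVOps.plus (j a) (j b)

theorem isChainEmbedding_id {C : Type} [Preorder C] [MVOps C] : IsChainEmbedding (id : C → C) :=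
  ⟨strictMono_id, rfl, fun _ => rfl, fun _ _ => rfl⟩

theorem exists_isChainEmbedding_unitInterval {m : ℕ} (hm : 0 < m) :
    ∃ j : Fin (m + 1) → unitInterval, IsChainEmbedding j := by
  have hm' : (0 : ℝ) < m := Nat.cast_pos.2 hm
  refine ⟨fun a => ⟨a / m, by positivity,
    (div_le_one hm').2 (Nat.cast_le.2 (Nat.le_of_lt_succ a.2))⟩, fun a b hab => ?_, ?_,
    fun a => ?_, fun a b => ?_⟩
  · exact div_lt_div_of_pos_right (Nat.cast_lt.2 hab) hm'
  · exact Subtype.ext (by simp [MVOps.zero])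
  · refine Subtype.ext ?_
    change ((m - a : ℕ) : ℝ) / m = 1 - (a : ℝ) / m
    rw [Nat.cast_sub (Nat.le_of_lt_succ a.2), sub_div, div_self hm'.ne']
  · refine Subtype.ext ?_
    change ((min m (a + b) : ℕ) : ℝ) / m = min 1 ((a : ℝ) / m + b / m)
    rw [Nat.cast_min, ← min_div_div_right hm'.le, div_self hm'.ne', Nat.cast_add, add_div]

namespace IsChainEmbedding

variable {C D : Type} [CompleteLinearOrder C] [MVOps C] [CompleteLinearOrder D] [MVOps D]
  {j : C → D} {ι : Type u} {X : Type w} [Finite ι] [Nonempty ι] {π : X → ι}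

/-- The homomorphism `f ↦ j ∘ f ∘ π` of function algebras induced by a chain embedding `j` and a
surjection `π` onto a finite set: finiteness makes the suprema and infima in `C` attained, so that
`j` preserves them. -/
noncomputable def functionHom (hj : IsChainEmbedding j) (hπ : Function.Surjective π) :
    functionAlgebra C ι →[monadicMVLang] functionAlgebra D X where
  toFun f x := j (f (π x))
  map_fun' f a := by
    have hmono := hj.strictMono.monotone
    cases f with
    | zero => exact funext fun _ => hj.map_zero
    | neg => exact funext fun x => hj.map_neg _
    | plus => exact funext fun x => hj.map_plus _ _
    | ex =>
      exact funext fun _ => (Finite.map_iSup_of_monotone (a 0) hmono).trans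
        (hπ.iSup_comp fun i => j (a 0 i)).symm
    | all =>
      exact funext fun _ => (Finite.map_iInf_of_monotone (a 0) hmono).trans
        (hπ.iInf_comp fun i => j (a 0 i)).symm
  map_rel' r := r.elim

theorem functionHom_injective (hj : IsChainEmbedding j) (hπ : Function.Surjective π) :
    Function.Injective (hj.functionHom hπ) :=
  hj.strictMono.injective.comp_left.comp hπ.injective_comp_right

end IsChainEmbedding

/-- A complete chain with MV-operations that satisfy the laws of MV-algebras and induce its
order. -/
structure IsCompleteMVChain (C : Type) [CompleteLinearOrder C] [MVOps C] : Prop where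
  plus_assoc : ∀ x y z : C, MVOps.plus x (MVOps.plus y z) = MVOps.plus (MVOps.plus x y) z
  plus_comm : ∀ x y : C, MVOps.plus x y = MVOps.plus y x
  plus_zero : ∀ x : C, MVOps.plus x MVOps.zero = x
  neg_neg : ∀ x : C, MVOps.neg (MVOps.neg x) = x
  plus_one : ∀ x : C, MVOps.plus x (MVOps.neg MVOps.zero) = MVOps.neg MVOps.zero
  lukasiewicz : ∀ x y : C, MVOps.plus (MVOps.neg (MVOps.plus (MVOps.neg x) y)) y =
    MVOps.plus (MVOps.neg (MVOps.plus (MVOps.neg y) x)) x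
  le_iff : ∀ x y : C, x ≤ y ↔ MVOps.plus (MVOps.neg x) y = MVOps.neg MVOps.zero

namespace IsCompleteMVChain

open MVOps

variable {C : Type} [CompleteLinearOrder C] [MVOps C]

theorem le_imp_comm (h : IsCompleteMVChain C) (a b c : C) :
    a ≤ plus (neg b) c ↔ b ≤ plus (neg a) c := by
  rw [h.le_iff, h.le_iff, h.plus_assoc, h.plus_assoc, h.plus_comm (neg a)]

theorem mul_le_iff_le_imp (h : IsCompleteMVChain C) (a b c : C) :
    neg (plus (neg a) (neg b)) ≤ c ↔ a ≤ plus (neg b) c := by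
  rw [h.le_iff, h.le_iff, h.neg_neg, h.plus_assoc]

theorem imp_imp_eq_sup (h : IsCompleteMVChain C) (a b : C) :
    plus (neg (plus (neg a) b)) b = a ⊔ b := by
  have of_le {a b : C} (hab : a ≤ b) : plus (neg (plus (neg a) b)) b = b := by
    rw [(h.le_iff a b).1 hab, h.neg_neg, h.plus_comm, h.plus_zero]
  rcases le_total a b with hab | hab
  · rw [of_le hab, sup_eq_right.2 hab]
  · rw [h.lukasiewicz, of_le hab, sup_eq_left.2 hab]

section Quantifiers

variable {ι : Sort*}

theorem iInf_imp_const (h : IsCompleteMVChain C) (f : ι → C) (c : C) :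
    ⨅ i, plus (neg (f i)) c = plus (neg (⨆ i, f i)) c :=
  eq_of_forall_le_iff fun t => by
    simp only [le_iInf_iff, h.le_imp_comm t, iSup_le_iff]

theorem iInf_const_imp (h : IsCompleteMVChain C) (c : C) (f : ι → C) :
    ⨅ i, plus (neg c) (f i) = plus (neg c) (⨅ i, f i) :=
  eq_of_forall_le_iff fun t => by
    simp only [le_iInf_iff, ← h.mul_le_iff_le_imp t]

theorem iInf_const_join (h : IsCompleteMVChain C) (c : C) (f : ι → C) :
    ⨅ i, plus (neg (plus (neg c) (f i))) (f i) =
      plus (neg (plus (neg c) (⨅ i, f i))) (⨅ i, f i) := by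
  simp only [h.imp_imp_eq_sup, sup_iInf_eq]

/- In a chain, `f i * f j` is at most `f k * f k` for `k` one of `i` and `j`. -/
theorem iSup_mul_self (h : IsCompleteMVChain C) (f : ι → C) :
    ⨆ i, neg (plus (neg (f i)) (neg (f i))) = neg (plus (neg (⨆ i, f i)) (neg (⨆ i, f i))) :=
  eq_of_forall_ge_iff fun t => by
    rw [iSup_le_iff, h.mul_le_iff_le_imp, iSup_le_iff]
    simp only [h.le_imp_comm _ (⨆ i, f i), iSup_le_iff, h.mul_le_iff_le_imp]
    refine ⟨fun hf i j => ?_, fun hf i => hf i i⟩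
    rcases le_total (f i) (f j) with hij | hij
    · rw [h.le_imp_comm]
      exact hij.trans (hf j)
    · exact hij.trans (hf i)

end Quantifiers

theorem functionAlgebra_mem_MMV (h : IsCompleteMVChain C) (X : Type u) :
    functionAlgebra C X ∈ MMV where
  plus_assoc _ _ _ := funext fun _ => h.plus_assoc _ _ _
  plus_comm _ _ := funext fun _ => h.plus_comm _ _
  plus_zero _ := funext fun _ => h.plus_zero _
  neg_neg _ := funext fun _ => h.neg_neg _
  plus_one _ := funext fun _ => h.plus_one _
  lukasiewicz _ _ := funext fun _ => h.lukasiewicz _ _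
  m1 f := funext fun x => (h.le_iff _ _).1 (iInf_le f x)
  m2 f g := funext fun _ => h.iInf_imp_const f (⨅ y, g y)
  m3 f g := funext fun _ => h.iInf_const_imp (⨅ y, f y) g
  m4 f g := funext fun _ => h.iInf_const_join (⨆ y, f y) g
  m5 f := funext fun _ => h.iSup_mul_self f

end IsCompleteMVChain

theorem isCompleteMVChain_fin (m : ℕ) : IsCompleteMVChain (Fin (m + 1)) := by
  have hneg (x : Fin (m + 1)) : ((MVOps.neg x : Fin (m + 1)) : ℕ) = m - x := rfl
  have hplus (x y : Fin (m + 1)) : ((MVOps.plus x y : Fin (m + 1)) : ℕ) = min m (x + y) := rfl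
  have hzero : ((MVOps.zero : Fin (m + 1)) : ℕ) = 0 := rfl
  constructor
  all_goals
    intros
    simp only [Fin.ext_iff, Fin.le_def, hneg, hplus, hzero]
    omega

theorem isCompleteMVChain_unitInterval : IsCompleteMVChain unitInterval := by
  have hneg (x : unitInterval) : ((MVOps.neg x : unitInterval) : ℝ) = 1 - x := rfl
  have hplus (x y : unitInterval) : ((MVOps.plus x y : unitInterval) : ℝ) = min 1 (x + y : ℝ) :=
    rfl
  have hzero : ((MVOps.zero : unitInterval) : ℝ) = 0 := rfl
  constructor
  all_goals
    intros
    simp only [Subtype.ext_iff, ← Subtype.coe_le_coe, hneg, hplus, hzero]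
    grind [unitInterval.nonneg, unitInterval.le_one]

section Axiomatization

open MonadicMV

/-- The term algebra: it makes the derived operations `→`, `*`, `∨` available on terms. -/
instance termStructure : monadicMVLang.Structure (monadicMVLang.Term ℕ) where
  funMap f ts := Term.func f ts
  RelMap r := r.elim

variable {A : Type u} [monadicMVLang.Structure A] (v : ℕ → A) (s t : monadicMVLang.Term ℕ)

theorem realize_zero : (zero : monadicMVLang.Term ℕ).realize v = zero := funMap_zero _

theorem realize_neg : (neg t).realize v = neg (t.realize v) := funMap_neg _

theorem realize_plus : (plus s t).realize v = plus (s.realize v) (t.realize v) := funMap_plus _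

theorem realize_ex : (ex t).realize v = ex (t.realize v) := funMap_ex _

theorem realize_all : (all t).realize v = all (t.realize v) := funMap_all _

/-- The defining identities of monadic MV-algebras, as pairs of terms. -/
def monadicMVIdentities : Set (monadicMVLang.Term ℕ × monadicMVLang.Term ℕ) :=
  let x : monadicMVLang.Term ℕ := Term.var 0
  let y : monadicMVLang.Term ℕ := Term.var 1
  let z : monadicMVLang.Term ℕ := Term.var 2
  {(plus x (plus y z), plus (plus x y) z),
    (plus x y, plus y x),
    (plus x zero, x),
    (neg (neg x), x),
    (plus x (neg zero), neg zero),
    (plus (neg (plus (neg x) y)) y, plus (neg (plus (neg y) x)) x),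
    (imp (all x) x, one),
    (all (imp x (all y)), imp (ex x) (all y)),
    (all (imp (all x) y), imp (all x) (all y)),
    (all (join (ex x) y), join (ex x) (all y)),
    (ex (mul x x), mul (ex x) (ex x))}

theorem isMonadicMV_iff_forall_realize_eq :
    IsMonadicMV A ↔ ∀ p ∈ monadicMVIdentities, ∀ v : ℕ → A, p.1.realize v = p.2.realize v := by
  simp only [monadicMVIdentities, Set.mem_insert_iff, Set.mem_singleton_iff, forall_eq_or_imp,
    forall_eq, one, imp, mul, join, realize_zero, realize_neg, realize_plus, realize_ex,
    realize_all, Term.realize_var]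
  refine ⟨fun h => ⟨fun _ => h.plus_assoc _ _ _, fun _ => h.plus_comm _ _, fun _ => h.plus_zero _,
    fun _ => h.neg_neg _, fun _ => h.plus_one _, fun _ => h.lukasiewicz _ _, fun _ => h.m1 _,
    fun _ => h.m2 _ _, fun _ => h.m3 _ _, fun _ => h.m4 _ _, fun _ => h.m5 _⟩, ?_⟩
  rintro ⟨assoc, comm, zero, neg, one, luk, m1, m2, m3, m4, m5⟩
  let v (x y z : A) : ℕ → A
    | 0 => x
    | 1 => y
    | _ => z
  exact
    { plus_assoc := fun x y z => assoc (v x y z)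
      plus_comm := fun x y => comm (v x y y)
      plus_zero := fun x => zero (v x x x)
      neg_neg := fun x => neg (v x x x)
      plus_one := fun x => one (v x x x)
      lukasiewicz := fun x y => luk (v x y y)
      m1 := fun x => m1 (v x x x)
      m2 := fun x y => m2 (v x y y)
      m3 := fun x y => m3 (v x y y)
      m4 := fun x y => m4 (v x y y)
      m5 := fun x => m5 (v x x x) }

end Axiomatization

theorem isQuasivariety_MMV : IsQuasivariety MMV.{u} := by
  refine ⟨(fun p => ⟨[], p.1, p.2⟩) '' monadicMVIdentities, Set.ext fun A => ?_⟩
  rw [Set.mem_ofPred_eq, Set.forall_mem_image]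
  exact isMonadicMV_iff_forall_realize_eq.trans
    (forall₂_congr fun _ _ => by simp [QuasiIdentity.HoldsIn])

theorem isGeneratedAsQuasivarietyBy_MMV_of_exists_injective {K : Set MonadicMVAlg.{u}}
    (hK : K ⊆ MMV) (hembed : ∀ (ι : Type u) [Finite ι] [Nonempty ι] (m : ℕ), 0 < m →
      ∃ B ∈ K, ∃ φ : functionAlgebra (Fin (m + 1)) ι →[monadicMVLang] B, Function.Injective φ) :
    IsGeneratedAsQuasivarietyBy MMV.{u} K := by
  refine ⟨⟨isQuasivariety_MMV, hK⟩, ?_⟩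
  rintro _ ⟨⟨Θ, rfl⟩, hKΘ⟩ A hA q hq
  by_contra hfail
  obtain ⟨ι, _, _, m, hm, hfail⟩ := q.exists_finite_not_holdsIn_functionAlgebra hA hfail
  obtain ⟨B, hB, φ, hφ⟩ := hembed ι m hm
  exact hfail ((hKΘ hB q hq).of_injective φ hφ)

theorem exists_surjective_ulift_nat (ι : Type*) [Countable ι] [Nonempty ι] :
    ∃ π : ULift.{w} ℕ → ι, Function.Surjective π := by
  obtain ⟨f, hf⟩ := exists_surjective_nat ι
  exact ⟨f ∘ ULift.down, hf.comp ULift.down_surjective⟩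

theorem mainTheorem7 :
    IsGeneratedAsQuasivarietyBy MMV.{u}
      {A | ∃ m : ℕ, 1 ≤ m ∧ A = functionAlgebra (Fin (m + 1)) (ULift.{u} ℕ)} ∧
    IsGeneratedAsQuasivarietyBy MMV.{u}
      {A | ∃ k : ℕ, 1 ≤ k ∧ A = functionAlgebra unitInterval (ULift.{u} (Fin k))} ∧
    IsGeneratedAsQuasivarietyBy MMV.{u}
      {functionAlgebra unitInterval (ULift.{u} ℕ)} := by
  refine ⟨isGeneratedAsQuasivarietyBy_MMV_of_exists_injective ?_ fun ι _ _ m hm => ?_,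
    isGeneratedAsQuasivarietyBy_MMV_of_exists_injective ?_ fun ι _ _ m hm => ?_,
    isGeneratedAsQuasivarietyBy_MMV_of_exists_injective ?_ fun ι _ _ m hm => ?_⟩
  · rintro _ ⟨m, -, rfl⟩
    exact (isCompleteMVChain_fin m).functionAlgebra_mem_MMV _
  · obtain ⟨π, hπ⟩ := exists_surjective_ulift_nat ι
    exact ⟨_, ⟨m, hm, rfl⟩, _, isChainEmbedding_id.functionHom_injective hπ⟩
  · rintro _ ⟨k, -, rfl⟩
    exact isCompleteMVChain_unitInterval.functionAlgebra_mem_MMV _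
  · obtain ⟨j, hj⟩ := exists_isChainEmbedding_unitInterval hm
    exact ⟨_, ⟨Nat.card ι, Nat.card_pos, rfl⟩, _,
      hj.functionHom_injective (Equiv.ulift.trans (Finite.equivFin ι).symm).surjective⟩
  · rintro _ rfl
    exact isCompleteMVChain_unitInterval.functionAlgebra_mem_MMV _
  · obtain ⟨j, hj⟩ := exists_isChainEmbedding_unitInterval hm
    obtain ⟨π, hπ⟩ := exists_surjective_ulift_nat ι
    exact ⟨_, rfl, _, hj.functionHom_injective hπ⟩
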